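/- Let $n\ge 1$ and let $\mathbb{H}^n=\mathbb{R}^{2n+1}$, with points $(x,y,t)$, $x,y\in\mathbb{R}^n$, $t\in\mathbb{R}$, be the Heisenberg group with group law $$(x,y,t)\cdot(x',y',t')=\Big(x+x',\,y+y',\,t+t'+2\sum_{j=1}^n (y_jx_j'-x_jy_j')\Big),$$ homogeneous norm $\rho(x,y,t)=\big((|x|^2+|y|^2)^2+t^2\big)^{1/4}$, balls $B(p,r)=\{q:\rho(p^{-1}q)<r\}$ ($p\in\mathbb{H}^n$, $r>0$), left-invariant horizontal vector fields $X_j=\partial_{x_j}+2y_j\partial_t$, $Y_j=\partial_{y_j}-2x_j\partial_t$, and homogeneous dimension $N=2n+2$. Let $dv$ be Lebesgue measure (a Haar measure of $\mathbb{H}^n$) and $|B|=\int_B dv$. For an open set $\Omega$ with smooth boundary let $d\sigma$ be the horizontal area element $$d\sigma=\Big(\sum_{j=1}^n\langle X_j,\nu\rangle^2+\langle Y_j,\nu\rangle^2\Big)^{1/2}dA\quad\text{on }\partial\Omega,$$ where $\nu$ is the Euclidean outer unit normal, $\langle\cdot,\cdot\rangle$ the Euclidean inner product and $dA$ the Euclidean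 surface measure of $\partial\Omega$. **Theorem.** For every $n\ge1$ and every $C_0\ge 0$ there is a constant $C_1<\infty$, depending only on $C_0$ and $N=2n+2$, with the following property. Let $\omega:\mathbb{H}^n\to[0,\infty]$ be a Borel measurable function that is an $A_1$ weight with constant $C_0$, that is, for every ball $B\subset\mathbb{H}^n$, $$\frac1{|B|}\int_B\omega\,dv\le C_0\inf_{z\in B}\omega(z),$$ where the infimum is the pointwise one. Then for every bounded open set (in particular, every bounded domain) $\Omega\subset\mathbb{H}^n$ with smooth boundary, $$\int_\Omega\omega\,dv\le C_1\Big(\int_{\partial\Omega}\omega^{\frac{N-1}{N}}\,d\sigma\Big)^{\frac{N}{N-1}}.$$ -/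

import Mathlib

open MeasureTheory Set
open scoped ENNReal NNReal Gradient

noncomputable section

/-- The underlying space `ℝ^{2n+1}` of the Heisenberg group `ℍⁿ`, with coordinates
`(x₁, …, xₙ, y₁, …, yₙ, t)`. Its Borel structure and Lebesgue measure `volume` are those of
Euclidean space; Lebesgue measure is a (bi-invariant) Haar measure of the group below. -/
abbrev Heisenberg (n : ℕ) : Type := EuclideanSpace ℝ ((Fin n ⊕ Fin n) ⊕ Unit)

namespace Heisenberg

variable {n : ℕ}

/-- The homogeneous dimension `N = 2n + 2` of `ℍⁿ`. -/
def homDim (n : ℕ) : ℕ := 2 * n + 2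

/-- The coordinate `x_j`. -/
def x (p : Heisenberg n) (j : Fin n) : ℝ := p (Sum.inl (Sum.inl j))

/-- The coordinate `y_j`. -/
def y (p : Heisenberg n) (j : Fin n) : ℝ := p (Sum.inl (Sum.inr j))

/-- The coordinate `t`. -/
def t (p : Heisenberg n) : ℝ := p (Sum.inr ())

/-- The point with coordinates `(a, b, c)`. -/
def mk (a b : Fin n → ℝ) (c : ℝ) : Heisenberg n :=
  WithLp.toLp 2 (Sum.elim (Sum.elim a b) (fun _ => c))

@[simp] lemma x_mk (a b : Fin n → ℝ) (c : ℝ) : x (mk a b c) = a := rfl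
@[simp] lemma y_mk (a b : Fin n → ℝ) (c : ℝ) : y (mk a b c) = b := rfl
@[simp] lemma t_mk (a b : Fin n → ℝ) (c : ℝ) : t (mk a b c) = c := rfl

lemma ext_coord {p q : Heisenberg n} (hx : ∀ j, x p j = x q j) (hy : ∀ j, y p j = y q j)
    (ht : t p = t q) : p = q := by
  ext i
  rcases i with (j | j) | j
  · exact hx j
  · exact hy j
  · exact ht

/-- The Heisenberg group law, with `z = x + i y`:
`(z, t) · (z', t') = (z + z', t + t' + 2 Im ⟨z, z'⟩)`, where
`Im ⟨z, z'⟩ = Im ∑ z_j (conj z'_j) = ∑ (y_j x'_j - x_j y'_j)`. -/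
instance : Group (Heisenberg n) where
  mul p q := mk (fun j => x p j + x q j) (fun j => y p j + y q j)
    (t p + t q + 2 * ∑ j, (y p j * x q j - x p j * y q j))
  one := mk 0 0 0
  inv p := mk (fun j => -x p j) (fun j => -y p j) (-t p)
  mul_assoc p q r := by
    refine ext_coord (fun j => add_assoc _ _ _) (fun j => add_assoc _ _ _) ?_
    change t p + t q + 2 * ∑ j, (y p j * x q j - x p j * y q j) + t r
        + 2 * ∑ j, ((y p j + y q j) * x r j - (x p j + x q j) * y r j)
      = t p + (t q + t r + 2 * ∑ j, (y q j * x r j - x q j * y r j))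
        + 2 * ∑ j, (y p j * (x q j + x r j) - x p j * (y q j + y r j))
    have h : ∑ j, (y p j * x q j - x p j * y q j)
          + ∑ j, ((y p j + y q j) * x r j - (x p j + x q j) * y r j)
        = ∑ j, (y q j * x r j - x q j * y r j)
          + ∑ j, (y p j * (x q j + x r j) - x p j * (y q j + y r j)) := by
      rw [← Finset.sum_add_distrib, ← Finset.sum_add_distrib]
      exact Finset.sum_congr rfl fun j _ => by ring
    linarith
  one_mul p := by
    refine ext_coord (fun j => zero_add _) (fun j => zero_add _) ?_
    change (0 : ℝ) + t p + 2 * ∑ j, ((0 : ℝ) * x p j - 0 * y p j) = t p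
    simp
  mul_one p := by
    refine ext_coord (fun j => add_zero _) (fun j => add_zero _) ?_
    change t p + (0 : ℝ) + 2 * ∑ j, (y p j * (0 : ℝ) - x p j * 0) = t p
    simp
  inv_mul_cancel p := by
    refine ext_coord (fun j => neg_add_cancel _) (fun j => neg_add_cancel _) ?_
    change -t p + t p + 2 * ∑ j, (-y p j * x p j - -x p j * y p j) = 0
    have h : ∑ j, (-y p j * x p j - -x p j * y p j) = 0 :=
      Finset.sum_eq_zero fun j _ => by ring
    rw [h]; ring

/-- The homogeneous norm `ρ(z, t) = (|z|⁴ + t²)^{1/4}`. -/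
def rho (p : Heisenberg n) : ℝ :=
  ((∑ j, (x p j ^ 2 + y p j ^ 2)) ^ 2 + t p ^ 2) ^ (1 / 4 : ℝ)

/-- The ball of centre `p` and radius `r` for the left-invariant distance `ρ(p⁻¹ q)`. -/
def ball (p : Heisenberg n) (r : ℝ) : Set (Heisenberg n) := {q | rho (p⁻¹ * q) < r}

/-- `ω` satisfies the `A₁` condition with constant `C₀`: its average over every ball is at most
`C₀` times its (pointwise) infimum over that ball. -/
def IsA1Weight (C₀ : ℝ≥0) (ω : Heisenberg n → ℝ≥0∞) : Prop :=
  ∀ (p : Heisenberg n) (r : ℝ), 0 < r →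
    (volume (ball p r))⁻¹ * ∫⁻ q in ball p r, ω q ≤ C₀ * ⨅ z ∈ ball p r, ω z

/-- The left-invariant horizontal vector field `X_j = ∂_{x_j} + 2 y_j ∂_t`. -/
def fieldX (j : Fin n) (p : Heisenberg n) : Heisenberg n := mk (Pi.single j 1) 0 (2 * y p j)

/-- The left-invariant horizontal vector field `Y_j = ∂_{y_j} - 2 x_j ∂_t`. -/
def fieldY (j : Fin n) (p : Heisenberg n) : Heisenberg n := mk 0 (Pi.single j 1) (-2 * x p j)

/-- `f` is a smooth defining function of `Ω` in the open set `U`: it has no critical point in `U`,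
and `Ω` is, inside `U`, the set where `f` is negative. -/
structure IsDefiningFunctionOn (Ω U : Set (Heisenberg n)) (f : Heisenberg n → ℝ) : Prop where
  isOpen : IsOpen U
  smooth : ContDiffOn ℝ (⊤ : ℕ∞) f U
  gradient_ne_zero : ∀ q ∈ U, ∇ f q ≠ 0
  mem_iff : ∀ q ∈ U, q ∈ Ω ↔ f q < 0

/-- `Ω` has smooth boundary: near each of its boundary points it has a smooth local defining
function. -/
def HasSmoothBoundary (Ω : Set (Heisenberg n)) : Prop :=
  ∀ p ∈ frontier Ω, ∃ U f, p ∈ U ∧ IsDefiningFunctionOn Ω U f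

/-- `ν` is the (Euclidean) outer unit normal of `Ω` at `p`. -/
def IsOuterUnitNormal (Ω : Set (Heisenberg n)) (p ν : Heisenberg n) : Prop :=
  ∃ U f, p ∈ U ∧ IsDefiningFunctionOn Ω U f ∧ ν = ‖∇ f p‖⁻¹ • ∇ f p

lemma IsDefiningFunctionOn.differentiableAt {Ω U : Set (Heisenberg n)} {f : Heisenberg n → ℝ}
    (h : IsDefiningFunctionOn Ω U f) {p : Heisenberg n} (hp : p ∈ U) :
    DifferentiableAt ℝ f p :=
  (h.smooth.contDiffAt (h.isOpen.mem_nhds hp)).differentiableAt (by simp)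

lemma IsDefiningFunctionOn.eq_zero {Ω U : Set (Heisenberg n)} {f : Heisenberg n → ℝ}
    (h : IsDefiningFunctionOn Ω U f) {p : Heisenberg n} (hpU : p ∈ U) (hp : p ∈ frontier Ω) :
    f p = 0 := by
  have hc := (h.differentiableAt hpU).continuousAt
  have hU := h.isOpen.mem_nhds hpU
  rcases lt_trichotomy (f p) 0 with hlt | heq | hgt
  · refine absurd (mem_interior_iff_mem_nhds.2 ?_) hp.2
    filter_upwards [hU, hc.eventually_lt_const hlt] with q hq hfq using (h.mem_iff q hq).2 hfq
  · exact heq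
  · obtain ⟨q, hqΩ, hq, hfq⟩ := ((mem_closure_iff_frequently.1 hp.1).and_eventually
      (Filter.Eventually.and hU (hc.eventually_const_lt hgt))).exists
    exact absurd ((h.mem_iff q hq).1 hqΩ) (not_lt.2 hfq.le)

lemma eventually_neg_of_inner_neg {f : Heisenberg n → ℝ} {p v : Heisenberg n}
    (hf : DifferentiableAt ℝ f p) (h0 : f p = 0) (hv : inner ℝ (∇ f p) v < 0) :
    ∀ᶠ s : ℝ in nhdsWithin 0 (Ioi 0), f (p + s • v) < 0 := by
  have h1 : HasDerivAt (fun s : ℝ => p + s • v) v 0 := by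
    simpa using ((hasDerivAt_id (0 : ℝ)).smul_const v).const_add p
  have h2 : HasDerivAt (fun s : ℝ => f (p + s • v)) (inner ℝ (∇ f p) v) 0 := by
    have hF : HasFDerivAt f (InnerProductSpace.toDual ℝ _ (∇ f p)) (p + (0 : ℝ) • v) := by
      simpa using hf.hasGradientAt.hasFDerivAt
    have h := hF.comp_hasDerivAt (0 : ℝ) h1
    rwa [InnerProductSpace.toDual_apply_apply] at h
  have h3 := (hasDerivAt_iff_tendsto_slope_zero.1 h2).eventually_lt_const hv
  filter_upwards [nhdsWithin_mono 0 (fun s (hs : 0 < s) => hs.ne') h3, self_mem_nhdsWithin]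
    with s hs hpos
  have hs' : s⁻¹ * f (p + s • v) < 0 := by simpa [h0] using hs
  exact (pos_iff_neg_of_mul_neg hs').1 (inv_pos.2 hpos)

/-- The outer unit normal at a boundary point does not depend on the defining function. -/
lemma IsOuterUnitNormal.unique {Ω : Set (Heisenberg n)} {p a b : Heisenberg n}
    (hp : p ∈ frontier Ω) (ha : IsOuterUnitNormal Ω p a) (hb : IsOuterUnitNormal Ω p b) :
    a = b := by
  obtain ⟨U, f, hpU, hf, rfl⟩ := ha
  obtain ⟨V, g, hpV, hg, rfl⟩ := hb
  have hfn : 0 < ‖∇ f p‖ := norm_pos_iff.2 (hf.gradient_ne_zero p hpU)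
  have hgn : 0 < ‖∇ g p‖ := norm_pos_iff.2 (hg.gradient_ne_zero p hpV)
  set a := ‖∇ f p‖⁻¹ • ∇ f p with ha
  set b := ‖∇ g p‖⁻¹ • ∇ g p with hb
  have ha1 : ‖a‖ = 1 := by rw [ha, norm_smul, norm_inv, norm_norm, inv_mul_cancel₀ hfn.ne']
  have hb1 : ‖b‖ = 1 := by rw [hb, norm_smul, norm_inv, norm_norm, inv_mul_cancel₀ hgn.ne']
  have hfa : ∇ f p = ‖∇ f p‖ • a := by rw [ha, smul_smul, mul_inv_cancel₀ hfn.ne', one_smul]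
  have hgb : ∇ g p = ‖∇ g p‖ • b := by rw [hb, smul_smul, mul_inv_cancel₀ hgn.ne', one_smul]
  by_contra hab
  have hlt : inner ℝ a b < 1 := (inner_lt_one_iff_real_of_norm_eq_one ha1 hb1).2 hab
  have h1 : inner ℝ (∇ f p) (b - a) < 0 := by
    rw [hfa, real_inner_smul_left, inner_sub_right, real_inner_self_eq_norm_sq, ha1]
    nlinarith
  have h2 : inner ℝ (∇ g p) (a - b) < 0 := by
    rw [hgb, real_inner_smul_left, inner_sub_right, real_inner_self_eq_norm_sq, hb1,
      real_inner_comm]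
    nlinarith
  have hg' : ∀ᶠ s : ℝ in nhdsWithin 0 (Ioi 0), 0 < g (p + s • (b - a)) := by
    have hgd := hg.differentiableAt hpV
    have hneg : ∇ (fun q => -g q) p = -∇ g p := by
      simp [gradient]
    have := eventually_neg_of_inner_neg (f := fun q => -g q) (v := b - a) hgd.neg
      (by simp [hg.eq_zero hpV hp]) (by
        rw [hneg, inner_neg_left, ← inner_neg_right, neg_sub]; exact h2)
    filter_upwards [this] with s hs using by linarith
  have hcont : Filter.Tendsto (fun s : ℝ => p + s • (b - a)) (nhdsWithin 0 (Ioi 0)) (nhds p) := by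
    have : Continuous fun s : ℝ => p + s • (b - a) := by fun_prop
    simpa using (this.tendsto 0).mono_left nhdsWithin_le_nhds
  obtain ⟨s, hs1, hs2, hs3, hs4⟩ := ((eventually_neg_of_inner_neg (hf.differentiableAt hpU)
    (hf.eq_zero hpU hp) h1).and (hg'.and ((hcont.eventually (hf.isOpen.mem_nhds hpU)).and
      (hcont.eventually (hg.isOpen.mem_nhds hpV))))).exists
  exact absurd ((hg.mem_iff _ hs4).1 ((hf.mem_iff _ hs3).2 hs1)) (not_lt.2 hs2.le)

open Classical in
/-- The outer unit normal of `Ω` at `p` (and `0` where there is none). By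
`IsOuterUnitNormal.unique` above, the choice is from a single vector at a boundary point. -/
def outerNormal (Ω : Set (Heisenberg n)) (p : Heisenberg n) : Heisenberg n :=
  if h : ∃ ν, IsOuterUnitNormal Ω p ν then h.choose else 0

/-- `|ν_H|`, the length of the horizontal part
`ν_H = ∑ ⟨X_j, ν⟩ X_j + ⟨Y_j, ν⟩ Y_j` of the outer unit normal. -/
def horizontalNormalLength (Ω : Set (Heisenberg n)) (p : Heisenberg n) : ℝ :=
  √(∑ j, (inner ℝ (fieldX j p) (outerNormal Ω p) ^ 2
    + inner ℝ (fieldY j p) (outerNormal Ω p) ^ 2))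

/-- The horizontal area element `dσ = |ν_H| dA` on the boundary of `Ω`, where `dA` is the Euclidean
surface measure, that is, the `2n`-dimensional Hausdorff measure of `ℝ^{2n+1}`. On a graph
`t = u(x, y)` it is `(∑ (∂_{x_j} u - 2 y_j)² + (∂_{y_j} u + 2 x_j)²)^{1/2} dx dy`. -/
def boundaryArea (Ω : Set (Heisenberg n)) : Measure (Heisenberg n) :=
  ((μHE[2 * n] : Measure (Heisenberg n)).restrict (frontier Ω)).withDensity
    fun p => ENNReal.ofReal (horizontalNormalLength Ω p)

end Heisenberg

end

noncomputable section

namespace Heisenberg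

variable {n : ℕ}

/-! ### Coordinates of products -/

/-! The unweighted local estimate comes from sweeping the boundary along horizontal segments. Moving
a piece `E` of the boundary by `q ↦ q * (τ • h)`, `0 ≤ τ ≤ 1`, produces volume at most `2 |h|` times
the horizontal area of `E`, since the Jacobian of the sweep is the component of the left-invariant
field of `h` across the boundary (`volume_sweep_le`).

Every `g` is a product of five horizontal elements of length at most `rho g`. If `p ∈ Ω` and `p * g
∉ Ω`, one of the five segments from `p` to `p * g` crosses the boundary, so the volume of such `p`
is controlled by the horizontal area. Integrating over `g` gives a relative isoperimetric inequality
in balls (`volume_inter_mul_volume_diff_le`).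

For the weight, choose for each `p ∈ Ω` a radius `r` at which `Ω` fills at most half, but a definite
part, of `ball p r`. Then `r ^ (N - 1)` is at most a constant times the boundary area in `ball p (6
^ 6 * r)` (`rpow_le_boundaryArea`). The `A₁` condition bounds the integral of `ω` over `ball p (6 ^
7 * r)` by a multiple of `r ^ N * inf ω`, which is the power `N / (N - 1)` of `r ^ (N - 1) * (inf ω)
^ ((N - 1) / N)` and hence is controlled by the weighted area in the smaller ball
(`setLIntegral_ball_le`). A Vitali covering makes the smaller balls disjoint while the larger ones
cover `Ω`, and the local bounds add up because `N / (N - 1) ≥ 1`. -/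

lemma x_mul (p q : Heisenberg n) (j : Fin n) : x (p * q) j = x p j + x q j := rfl

lemma y_mul (p q : Heisenberg n) (j : Fin n) : y (p * q) j = y p j + y q j := rfl

lemma t_mul (p q : Heisenberg n) :
    t (p * q) = t p + t q + 2 * ∑ j, (y p j * x q j - x p j * y q j) := rfl

lemma x_inv (p : Heisenberg n) (j : Fin n) : x p⁻¹ j = -x p j := rfl

lemma y_inv (p : Heisenberg n) (j : Fin n) : y p⁻¹ j = -y p j := rfl

lemma t_inv (p : Heisenberg n) : t p⁻¹ = -t p := rfl

lemma x_one (j : Fin n) : x (1 : Heisenberg n) j = 0 := rfl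

lemma y_one (j : Fin n) : y (1 : Heisenberg n) j = 0 := rfl

lemma t_one : t (1 : Heisenberg n) = 0 := rfl

lemma x_add (p q : Heisenberg n) (j : Fin n) : x (p + q) j = x p j + x q j := rfl

lemma y_add (p q : Heisenberg n) (j : Fin n) : y (p + q) j = y p j + y q j := rfl

lemma t_add (p q : Heisenberg n) : t (p + q) = t p + t q := rfl

lemma x_smul (r : ℝ) (p : Heisenberg n) (j : Fin n) : x (r • p) j = r * x p j := rfl

lemma y_smul (r : ℝ) (p : Heisenberg n) (j : Fin n) : y (r • p) j = r * y p j := rfl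

lemma t_smul (r : ℝ) (p : Heisenberg n) : t (r • p) = r * t p := rfl

/-! ### The homogeneous norm -/

/-- The squared length `|z|²` of the horizontal part of `(z, t)`. -/
def sqLen (p : Heisenberg n) : ℝ := ∑ j, (x p j ^ 2 + y p j ^ 2)

lemma sqLen_nonneg (p : Heisenberg n) : 0 ≤ sqLen p :=
  Finset.sum_nonneg fun _ _ => by positivity

lemma rho_eq (p : Heisenberg n) : rho p = (sqLen p ^ 2 + t p ^ 2) ^ (1 / 4 : ℝ) := rfl

lemma rho_nonneg (p : Heisenberg n) : 0 ≤ rho p := by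
  rw [rho_eq]; positivity

lemma rho_pow_four (p : Heisenberg n) : rho p ^ 4 = sqLen p ^ 2 + t p ^ 2 := by
  rw [rho_eq, ← Real.rpow_natCast, ← Real.rpow_mul (by positivity)]
  norm_num

lemma sqLen_le_rho_sq (p : Heisenberg n) : sqLen p ≤ rho p ^ 2 := by
  apply le_of_sq_le_sq _ (by positivity)
  nlinarith [rho_pow_four p, sq_nonneg (t p)]

lemma abs_t_le_rho_sq (p : Heisenberg n) : |t p| ≤ rho p ^ 2 := by
  apply abs_le_of_sq_le_sq _ (by positivity)
  nlinarith [rho_pow_four p, sq_nonneg (sqLen p)]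

/-- The sharp factor would be `2 ^ (1 / 4)`; a factor `2` keeps later constants simple. -/
lemma rho_le_of_le {p : Heisenberg n} {s : ℝ} (hs : 0 ≤ s) (h1 : sqLen p ≤ s ^ 2)
    (h2 : |t p| ≤ s ^ 2) : rho p ≤ 2 * s := by
  apply le_of_pow_le_pow_left₀ (n := 4) (by norm_num) (by positivity)
  rw [rho_pow_four]
  have h3 : sqLen p ^ 2 ≤ (s ^ 2) ^ 2 := by
    gcongr
    exact sqLen_nonneg p
  have h4 : t p ^ 2 ≤ (s ^ 2) ^ 2 := sq_le_sq' (by linarith [neg_abs_le (t p)])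
    (by linarith [le_abs_self (t p)])
  nlinarith [pow_nonneg hs 4]

lemma sq_sum_mul_add_mul_le (a b c d : Fin n → ℝ) :
    (∑ j, (a j * c j + b j * d j)) ^ 2 ≤ (∑ j, (a j ^ 2 + b j ^ 2)) * ∑ j, (c j ^ 2 + d j ^ 2) := by
  have h := Finset.sum_mul_sq_le_sq_mul_sq Finset.univ (Sum.elim a b) (Sum.elim c d)
  simpa [Fintype.sum_sum_type, Finset.sum_add_distrib] using h

/-- Cauchy–Schwarz for the cross term; with the analogous bound on `t` it gives the quasi-triangle
inequality. -/
lemma sqLen_mul_le (p q : Heisenberg n) : sqLen (p * q) ≤ (rho p + rho q) ^ 2 := by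
  have h1 : sqLen (p * q) = sqLen p + sqLen q + 2 * ∑ j, (x p j * x q j + y p j * y q j) := by
    simp only [sqLen, x_mul, y_mul, Finset.mul_sum, ← Finset.sum_add_distrib]
    exact Finset.sum_congr rfl fun j _ => by ring
  have h2 : ∑ j, (x p j * x q j + y p j * y q j) ≤ rho p * rho q := by
    apply le_of_sq_le_sq _ (mul_nonneg (rho_nonneg p) (rho_nonneg q))
    calc _ ≤ sqLen p * sqLen q := sq_sum_mul_add_mul_le _ _ _ _
      _ ≤ rho p ^ 2 * rho q ^ 2 := by
        gcongr
        exacts [sqLen_nonneg q, sqLen_le_rho_sq p, sqLen_le_rho_sq q]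
      _ = _ := by ring
  nlinarith [sqLen_le_rho_sq p, sqLen_le_rho_sq q]

lemma abs_t_mul_le (p q : Heisenberg n) : |t (p * q)| ≤ (rho p + rho q) ^ 2 := by
  have h2 : |∑ j, (y p j * x q j - x p j * y q j)| ≤ rho p * rho q := by
    apply abs_le_of_sq_le_sq _ (mul_nonneg (rho_nonneg p) (rho_nonneg q))
    calc _ = (∑ j, (x p j * (-y q j) + y p j * x q j)) ^ 2 := by
          congr 1
          exact Finset.sum_congr rfl fun j _ => by ring
      _ ≤ sqLen p * (∑ j, ((-y q j) ^ 2 + x q j ^ 2)) := sq_sum_mul_add_mul_le _ _ _ _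
      _ = sqLen p * sqLen q := by
          congr 1
          exact Finset.sum_congr rfl fun j _ => by ring
      _ ≤ rho p ^ 2 * rho q ^ 2 := by
        gcongr
        exacts [sqLen_nonneg q, sqLen_le_rho_sq p, sqLen_le_rho_sq q]
      _ = _ := by ring
  rw [t_mul]
  rw [abs_le] at h2 ⊢
  have h3 := abs_le.1 (abs_t_le_rho_sq p)
  have h4 := abs_le.1 (abs_t_le_rho_sq q)
  constructor <;> nlinarith

/-- The homogeneous norm satisfies a quasi-triangle inequality. -/
lemma rho_mul_le (p q : Heisenberg n) : rho (p * q) ≤ 2 * (rho p + rho q) :=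
  rho_le_of_le (add_nonneg (rho_nonneg p) (rho_nonneg q)) (sqLen_mul_le p q) (abs_t_mul_le p q)

lemma rho_inv (p : Heisenberg n) : rho p⁻¹ = rho p := by
  simp only [rho, x_inv, y_inv, t_inv, neg_sq]

lemma rho_one : rho (1 : Heisenberg n) = 0 := by
  rw [← pow_eq_zero_iff (n := 4) (by norm_num), rho_pow_four]
  simp [sqLen, x_one, y_one, t_one]

lemma rho_inv_mul_comm (p q : Heisenberg n) : rho (p⁻¹ * q) = rho (q⁻¹ * p) := by
  rw [← rho_inv, mul_inv_rev, inv_inv]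

lemma mem_ball_self (p : Heisenberg n) {r : ℝ} (hr : 0 < r) : p ∈ ball p r := by
  simpa [ball, rho_one] using hr

lemma ball_subset_ball (p : Heisenberg n) {r s : ℝ} (h : r ≤ s) : ball p r ⊆ ball p s :=
  fun _ hq => lt_of_lt_of_le hq h

/-! ### Topology and measure -/

lemma continuous_x (j : Fin n) : Continuous fun p : Heisenberg n => x p j := by
  unfold x; fun_prop

lemma continuous_y (j : Fin n) : Continuous fun p : Heisenberg n => y p j := by
  unfold y; fun_prop

lemma continuous_t : Continuous fun p : Heisenberg n => t p := by
  unfold t; fun_prop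

lemma continuous_of_coord {α : Type*} [TopologicalSpace α] {f : α → Heisenberg n}
    (hx : ∀ j, Continuous fun a => x (f a) j) (hy : ∀ j, Continuous fun a => y (f a) j)
    (ht : Continuous fun a => t (f a)) : Continuous f := by
  refine (PiLp.continuous_toLp 2 _).comp (f := fun a => (f a).ofLp) (continuous_pi ?_)
  rintro ((j | j) | j)
  exacts [hx j, hy j, ht]

instance : ContinuousMul (Heisenberg n) where
  continuous_mul := by
    refine continuous_of_coord (fun j => ?_) (fun j => ?_) ?_
    · simp only [x_mul]
      exact ((continuous_x j).comp continuous_fst).add ((continuous_x j).comp continuous_snd)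
    · simp only [y_mul]
      exact ((continuous_y j).comp continuous_fst).add ((continuous_y j).comp continuous_snd)
    · simp only [t_mul]
      refine ((continuous_t.comp continuous_fst).add (continuous_t.comp continuous_snd)).add
        (continuous_const.mul (continuous_finsetSum _ fun j _ => ?_))
      exact (((continuous_y j).comp continuous_fst).mul ((continuous_x j).comp continuous_snd)).sub
        (((continuous_x j).comp continuous_fst).mul ((continuous_y j).comp continuous_snd))

instance : ContinuousInv (Heisenberg n) where
  continuous_inv := continuous_of_coord (fun j => (continuous_x j).neg)
    (fun j => (continuous_y j).neg) continuous_t.neg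

lemma continuous_sqLen : Continuous (sqLen : Heisenberg n → ℝ) :=
  continuous_finsetSum _ fun j _ => ((continuous_x j).pow 2).add ((continuous_y j).pow 2)

lemma continuous_rho : Continuous (rho : Heisenberg n → ℝ) :=
  ((continuous_sqLen.pow 2).add (continuous_t.pow 2)).rpow_const fun _ => Or.inr (by norm_num)

lemma isOpen_ball (p : Heisenberg n) (r : ℝ) : IsOpen (ball p r) :=
  isOpen_lt (continuous_rho.comp (continuous_const_mul p⁻¹)) continuous_const

/-! ### Translations and dilations as linear algebra; volumes of balls. -/

/-- The `t`-direction, which spans the centre. -/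
def centralDir : Heisenberg n := mk 0 0 1

/-- The symplectic form `2 Im ⟨a, ·⟩` as a linear form. -/
def symplectic (a : Heisenberg n) : Heisenberg n →ₗ[ℝ] ℝ where
  toFun p := 2 * ∑ j, (y a j * x p j - x a j * y p j)
  map_add' p q := by
    rw [← mul_add, ← Finset.sum_add_distrib]
    congr 1
    exact Finset.sum_congr rfl fun j _ => by rw [x_add, y_add]; ring
  map_smul' r p := by
    simp only [RingHom.id_apply, smul_eq_mul, x_smul, y_smul, Finset.mul_sum]
    exact Finset.sum_congr rfl fun j _ => by ring

lemma symplectic_apply (a p : Heisenberg n) :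
    symplectic a p = 2 * ∑ j, (y a j * x p j - x a j * y p j) := rfl

lemma symplectic_centralDir (a : Heisenberg n) : symplectic a centralDir = 0 := by
  simp [symplectic_apply, centralDir]

lemma symplectic_self (a : Heisenberg n) : symplectic a a = 0 := by
  rw [symplectic_apply, Finset.sum_eq_zero fun j _ => by ring, mul_zero]

/-- Translations are affine with linear part a shear towards the centre, which has determinant one.
This is why Lebesgue measure is invariant on both sides. -/
lemma mul_eq_add_transvection (a p : Heisenberg n) :
    a * p = a + LinearMap.transvection (symplectic a) centralDir p := by
  rw [LinearMap.transvection.apply]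
  refine ext_coord (fun j => ?_) (fun j => ?_) ?_
  · simp [x_mul, x_add, x_smul, centralDir]
  · simp [y_mul, y_add, y_smul, centralDir]
  · simp only [t_mul, t_add, t_smul, centralDir, t_mk, symplectic_apply]; ring

lemma mul_eq_add_transvection' (p a : Heisenberg n) :
    p * a = a + LinearMap.transvection (-symplectic a) centralDir p := by
  rw [LinearMap.transvection.apply]
  refine ext_coord (fun j => ?_) (fun j => ?_) ?_
  · change x p j + x a j = x a j + (x p j + (-symplectic a p) * 0)
    ring
  · change y p j + y a j = y a j + (y p j + (-symplectic a p) * 0)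
    ring
  · simp only [t_mul, t_add, t_smul, centralDir, t_mk, symplectic_apply, LinearMap.neg_apply]
    have : ∑ j, (y p j * x a j - x p j * y a j) = - ∑ j, (y a j * x p j - x a j * y p j) := by
      rw [← Finset.sum_neg_distrib]
      exact Finset.sum_congr rfl fun j _ => by ring
    rw [this]; ring

lemma measurePreserving_of_det_eq_one {f : Heisenberg n →ₗ[ℝ] Heisenberg n}
    (hf : LinearMap.det f = 1) : MeasurePreserving f := by
  refine ⟨f.continuous_of_finiteDimensional.measurable, ?_⟩
  rw [Measure.map_linearMap_addHaar_eq_smul_addHaar _ (by simp [hf]), hf]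
  simp

lemma measurePreserving_mul_left_volume (a : Heisenberg n) :
    MeasurePreserving (fun p : Heisenberg n => a * p) := by
  have h : MeasurePreserving (LinearMap.transvection (symplectic a) centralDir) :=
    measurePreserving_of_det_eq_one
      (by rw [LinearMap.transvection.det, symplectic_centralDir, add_zero])
  convert! (measurePreserving_add_left volume a).comp h using 1
  exact funext fun p => mul_eq_add_transvection a p

lemma measurePreserving_mul_right_volume (a : Heisenberg n) :
    MeasurePreserving (fun p : Heisenberg n => p * a) := by
  have h : MeasurePreserving (LinearMap.transvection (-symplectic a) centralDir) :=
    measurePreserving_of_det_eq_one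
      (by rw [LinearMap.transvection.det, LinearMap.neg_apply, symplectic_centralDir, neg_zero,
        add_zero])
  convert! (measurePreserving_add_left volume a).comp h using 1
  exact funext fun p => mul_eq_add_transvection' p a

instance : (volume : Measure (Heisenberg n)).IsMulLeftInvariant :=
  ⟨fun a => (measurePreserving_mul_left_volume a).map_eq⟩

instance : (volume : Measure (Heisenberg n)).IsMulRightInvariant :=
  ⟨fun a => (measurePreserving_mul_right_volume a).map_eq⟩

/-- The parabolic dilation `(z, t) ↦ (r z, r² t)`. -/
def dilation (r : ℝ) : Heisenberg n →ₗ[ℝ] Heisenberg n :=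
  r • LinearMap.transvection ((r - 1) • (EuclideanSpace.projₗ (Sum.inr ()) :
    Heisenberg n →ₗ[ℝ] ℝ)) centralDir

lemma dilation_apply (r : ℝ) (p : Heisenberg n) :
    dilation r p = r • (p + ((r - 1) * t p) • centralDir) := rfl

/-- The scalar `r` contributes `r ^ (2n + 1)` and the transvection one more factor `1 + (r - 1) =
r`. -/
lemma det_dilation (r : ℝ) :
    LinearMap.det (dilation r : Heisenberg n →ₗ[ℝ] Heisenberg n) = r ^ homDim n := by
  have h : (EuclideanSpace.projₗ (Sum.inr ()) : Heisenberg n →ₗ[ℝ] ℝ) centralDir = 1 := rfl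
  rw [dilation, LinearMap.det_smul, LinearMap.transvection.det, LinearMap.smul_apply, h, homDim]
  simp only [finrank_euclideanSpace, Fintype.card_sum, Fintype.card_fin, Fintype.card_unit,
    smul_eq_mul]
  ring

lemma rho_dilation {r : ℝ} (hr : 0 ≤ r) (p : Heisenberg n) : rho (dilation r p) = r * rho p := by
  apply (pow_left_inj₀ (rho_nonneg _) (mul_nonneg hr (rho_nonneg _)) (n := 4) (by norm_num)).1
  have h1 : sqLen (dilation r p) = r ^ 2 * sqLen p := by
    simp only [sqLen, dilation_apply, x_smul, y_smul, x_add, y_add, centralDir, x_mk, y_mk,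
      Finset.mul_sum]
    exact Finset.sum_congr rfl fun j _ => by simp; ring
  have h2 : t (dilation r p) = r ^ 2 * t p := by
    simp only [dilation_apply, t_smul, t_add, centralDir, t_mk]; ring
  rw [mul_pow, rho_pow_four, rho_pow_four, h1, h2]
  ring

lemma volume_ball_eq (p : Heisenberg n) {r : ℝ} (hr : 0 < r) :
    volume (ball p r) = ENNReal.ofReal (r ^ homDim n) * volume (ball (1 : Heisenberg n) 1) := by
  have h1 : volume (ball p r) = volume (ball (1 : Heisenberg n) r) := by
    have : ball p r = (fun q => p⁻¹ * q) ⁻¹' ball 1 r := by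
      ext q; simp [ball]
    rw [this, measure_preimage_mul]
  have h2 : dilation r ⁻¹' ball (1 : Heisenberg n) r = ball 1 1 := by
    ext q
    simp only [mem_preimage, ball, mem_ofPred_eq, inv_one, one_mul, rho_dilation hr.le]
    constructor <;> intro h <;> nlinarith
  have h3 := Measure.addHaar_preimage_linearMap (volume : Measure (Heisenberg n))
    (f := dilation r) (by rw [det_dilation]; positivity) (ball 1 r)
  rw [h2, det_dilation, abs_of_pos (by positivity)] at h3
  rw [h1, h3, ← mul_assoc, ← ENNReal.ofReal_mul (by positivity), mul_inv_cancel₀ (by positivity),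
    ENNReal.ofReal_one, one_mul]

lemma volume_unitBall_pos : 0 < volume (ball (1 : Heisenberg n) 1) :=
  (isOpen_ball _ _).measure_pos _ ⟨1, mem_ball_self _ one_pos⟩

lemma norm_sq_eq (p : Heisenberg n) : ‖p‖ ^ 2 = sqLen p + t p ^ 2 := by
  rw [EuclideanSpace.norm_sq_eq]
  simp [Fintype.sum_sum_type, sqLen, Finset.sum_add_distrib, x, y, t]

lemma volume_unitBall_lt_top : volume (ball (1 : Heisenberg n) 1) < ∞ := by
  refine (measure_mono (t := Metric.closedBall 0 2) fun p hp => ?_).trans_lt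
    (isCompact_closedBall _ _).measure_lt_top
  have hp' : rho p < 1 := by simpa [ball] using hp
  have h0 := rho_nonneg p
  have h1 := sqLen_le_rho_sq p
  have h2 := abs_t_le_rho_sq p
  have h3 : t p ^ 2 ≤ 1 := by
    rw [← sq_abs]
    exact pow_le_one₀ (abs_nonneg _) (h2.trans (pow_le_one₀ h0 hp'.le))
  rw [mem_closedBall_zero_iff]
  nlinarith [norm_sq_eq p, norm_nonneg p]

lemma volume_ball_pos (p : Heisenberg n) {r : ℝ} (hr : 0 < r) : 0 < volume (ball p r) :=
  (isOpen_ball _ _).measure_pos _ ⟨p, mem_ball_self _ hr⟩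

lemma volume_ball_lt_top (p : Heisenberg n) {r : ℝ} (hr : 0 < r) : volume (ball p r) < ∞ := by
  rw [volume_ball_eq p hr]
  exact ENNReal.mul_lt_top ENNReal.ofReal_lt_top volume_unitBall_lt_top

/-- Dilating the radius by a factor `s` multiplies the volume of a ball by `s ^ N`. -/
lemma volume_ball_mul (p q : Heisenberg n) {s r : ℝ} (hs : 0 < s) (hr : 0 < r) :
    volume (ball p (s * r)) = ENNReal.ofReal (s ^ homDim n) * volume (ball q r) := by
  rw [volume_ball_eq p (mul_pos hs hr), volume_ball_eq q hr, mul_pow,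
    ENNReal.ofReal_mul (by positivity), mul_assoc]

end Heisenberg

/-! ### Integration over a hyperplane and over sections of an orthogonal projection. -/

section Projection

open Module

variable {V : Type*} [NormedAddCommGroup V] [InnerProductSpace ℝ V]

lemma coe_orthogonalProjectionOnto_orthogonal_unit_singleton {e : V} (he : ‖e‖ = 1) (u : V) :
    ((ℝ ∙ e)ᗮ.orthogonalProjectionOnto u : V) = u - inner ℝ e u • e := by
  rw [← Submodule.starProjection_unit_singleton ℝ he, Submodule.coe_orthogonalProjectionOnto_apply,
    Submodule.starProjection_orthogonal_val]

variable [FiniteDimensional ℝ V] [MeasurableSpace V] [BorelSpace V]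

/-- Integrating over the slab `0 ≤ ⟪e, u⟫ ≤ 1` a function of the projection of `u` to the
hyperplane `e^⊥` amounts to integrating over that hyperplane. -/
lemma lintegral_slab_comp_orthogonalProjection {e : V} (he : ‖e‖ = 1) {F : (ℝ ∙ e)ᗮ → ℝ≥0∞}
    (hF : Measurable F) :
    ∫⁻ u in {u : V | inner ℝ e u ∈ Icc (0 : ℝ) 1}, F ((ℝ ∙ e)ᗮ.orthogonalProjectionOnto u)
      = ∫⁻ w, F w := by
  have hmp := (ℝ ∙ e).measurePreserving_measurableEquivProd (0 : V)
  rw [InnerProductSpace.euclideanHausdorffMeasure_eq_volume] at hmp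
  let I : ℝ ≃ₗᵢ[ℝ] (ℝ ∙ e) := LinearIsometryEquiv.toSpanUnitSingleton e he
  let S : Set (ℝ ∙ e) := {v | inner ℝ e (v : V) ∈ Icc (0 : ℝ) 1}
  have hS : MeasurableSet S := by
    refine (measurableSet_Icc (a := (0 : ℝ)) (b := 1)).preimage ?_
    exact (continuous_const.inner continuous_subtype_val).measurable
  have hvol : volume S = 1 := by
    rw [← I.measurePreserving.measure_preimage hS.nullMeasurableSet]
    have : I ⁻¹' S = Icc 0 1 := by
      ext r
      simp [S, I, inner_smul_right, he]
    simp [this]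
  have hset : {u : V | inner ℝ e u ∈ Icc (0 : ℝ) 1}
      = (ℝ ∙ e).measurableEquivProd (0 : V) ⁻¹' (S ×ˢ univ) := by
    ext u
    have h : inner ℝ e ((ℝ ∙ e).orthogonalProjectionOnto u : V) = inner ℝ e u := by
      rw [Submodule.coe_orthogonalProjectionOnto_apply,
        Submodule.starProjection_unit_singleton ℝ he, inner_smul_right,
        real_inner_self_eq_norm_sq, he]
      simp
    simp only [mem_preimage, mem_prod, mem_univ, and_true, S, mem_ofPred_eq,
      Submodule.measurableEquivProd_apply, vsub_eq_sub, sub_zero, h]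
  have hcomp : ∀ u : V, F ((ℝ ∙ e)ᗮ.orthogonalProjectionOnto u)
      = (fun z : (ℝ ∙ e) × (ℝ ∙ e)ᗮ => F z.2) ((ℝ ∙ e).measurableEquivProd (0 : V) u) := by
    intro u; simp
  simp_rw [hcomp]
  rw [hset, hmp.setLIntegral_comp_preimage (hS.prod MeasurableSet.univ)
    (f := fun z => F z.2) (hF.comp measurable_snd), Measure.volume_eq_prod, ← Measure.prod_restrict]
  have := lintegral_prod_mul (μ := volume.restrict S) (ν := volume.restrict univ)
    (f := fun _ : ℝ ∙ e => (1 : ℝ≥0∞)) (g := F) aemeasurable_const hF.aemeasurable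
  simpa [hvol] using this

/-- Integrating over a piece of a subspace that parametrises a set `E` by a section of the
orthogonal projection gives at most the integral over `E` against the Hausdorff measure. -/
lemma lintegral_comp_section_le {K : Submodule ℝ V} {d : ℕ} (hd : finrank ℝ K = d) {W : Set K}
    (hW : MeasurableSet W) {ψ : K → V} (hψ : ContinuousOn ψ W) {E : Set V}
    (hmaps : MapsTo ψ W E) (hsec : ∀ w ∈ W, K.orthogonalProjectionOnto (ψ w) = w)
    {J : V → ℝ≥0∞} (hJ : AEMeasurable J ((μHE[d] : Measure V).restrict E)) :
    ∫⁻ w in W, J (ψ w) ≤ ∫⁻ q in E, J q ∂μHE[d] := by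
  have hψm : AEMeasurable ψ (volume.restrict W) := hψ.aemeasurable hW
  -- The part of `W` mapped into `A` is contained in the projection of `A ∩ E`, and orthogonal
  -- projections, being 1-Lipschitz, do not increase Hausdorff measure. No area formula on `E` is
  -- needed.
  have hle : (volume.restrict W).map ψ ≤ (μHE[d] : Measure V).restrict E := by
    refine Measure.le_iff.2 fun A hA => ?_
    rw [Measure.map_apply_of_aemeasurable hψm hA, Measure.restrict_apply' hW,
      Measure.restrict_apply hA]
    calc volume (ψ ⁻¹' A ∩ W) ≤ volume (K.orthogonalProjectionOnto '' (A ∩ E)) :=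
          measure_mono fun w hw => ⟨ψ w, ⟨hw.1, hmaps hw.2⟩, hsec w hw.2⟩
      _ ≤ μHE[d] (A ∩ E) := by
        rw [← InnerProductSpace.euclideanHausdorffMeasure_eq_volume, hd]
        simp_rw [Measure.euclideanHausdorffMeasure_def, Measure.smul_apply]
        gcongr
        simpa using K.lipschitzWith_orthogonalProjectionOnto.hausdorffMeasure_image_le
          (Nat.cast_nonneg d) (A ∩ E)
  calc ∫⁻ w in W, J (ψ w) = ∫⁻ q, J q ∂((volume.restrict W).map ψ) :=
        (lintegral_map' (hJ.mono_measure hle) hψm).symm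
    _ ≤ _ := lintegral_mono' hle le_rfl

end Projection

namespace Heisenberg

variable {n : ℕ}

/-! ### Horizontal segments -/

/-- The value at `q` of the left-invariant vector field whose value at the origin is `h`. -/
def leftField (h q : Heisenberg n) : Heisenberg n := h + symplectic q h • centralDir

lemma symplectic_comm (a b : Heisenberg n) : symplectic a b = -symplectic b a := by
  rw [symplectic_apply, symplectic_apply, ← mul_neg, ← Finset.sum_neg_distrib]
  congr 1
  exact Finset.sum_congr rfl fun j _ => by ring

lemma mul_smul_eq_add_leftField (q h : Heisenberg n) (τ : ℝ) :
    q * (τ • h) = q + τ • leftField h q := by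
  rw [mul_eq_add_transvection, LinearMap.transvection.apply, leftField, map_smul, smul_add,
    smul_smul, smul_eq_mul]

lemma leftField_eq_sum {h : Heisenberg n} (ht : t h = 0) (q : Heisenberg n) :
    leftField h q = ∑ j, (x h j • fieldX j q + y h j • fieldY j q) := by
  have hsum : ∀ (i : (Fin n ⊕ Fin n) ⊕ Unit) (f : Fin n → Heisenberg n),
      (∑ j, f j) i = ∑ j, f j i := fun i f => by simp
  refine ext_coord (fun j => ?_) (fun j => ?_) ?_
  · rw [x, x, hsum]
    change x h j + symplectic q h * 0 = ∑ k, (x h k * (Pi.single k (1 : ℝ) : Fin n → ℝ) j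
      + y h k * 0)
    simp [Pi.single_apply]
  · rw [y, y, hsum]
    change y h j + symplectic q h * 0 = ∑ k, (x h k * 0
      + y h k * (Pi.single k (1 : ℝ) : Fin n → ℝ) j)
    simp [Pi.single_apply]
  · rw [t, t, hsum]
    change t h + symplectic q h * 1 = ∑ k, (x h k * (2 * y q k) + y h k * (-2 * x q k))
    rw [ht, symplectic_apply, zero_add, mul_one, Finset.mul_sum]
    exact Finset.sum_congr rfl fun j _ => by ring

/-- Cauchy–Schwarz in the expansion of the left-invariant field along `fieldX` and `fieldY`. This is
where the horizontal part of the normal enters. -/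
lemma abs_inner_leftField_le {h : Heisenberg n} (ht : t h = 0) (q ν : Heisenberg n) :
    |inner ℝ ν (leftField h q)| ≤
      √(sqLen h) * √(∑ j, (inner ℝ (fieldX j q) ν ^ 2 + inner ℝ (fieldY j q) ν ^ 2)) := by
  rw [← Real.sqrt_mul (sqLen_nonneg h)]
  apply Real.abs_le_sqrt
  rw [leftField_eq_sum ht, inner_sum]
  simp only [inner_add_right, inner_smul_right]
  simpa only [sqLen, real_inner_comm ν] using sq_sum_mul_add_mul_le (x h) (y h)
    (fun j => inner ℝ (fieldX j q) ν) (fun j => inner ℝ (fieldY j q) ν)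

/-! ### The sweep of a hypersurface along a horizontal segment -/

/-- Moving `ψ (P u)` along the left-invariant field of `h` for the time `⟪e, u⟫`. -/
def flowOut (ψ : Heisenberg n → Heisenberg n) (e h u : Heisenberg n) : Heisenberg n :=
  ψ ((ℝ ∙ e)ᗮ.orthogonalProjectionOnto u) * (inner ℝ e u • h)

/-- The derivative of `flowOut`. -/
def flowOutDeriv (A : Heisenberg n →L[ℝ] Heisenberg n) (e h q u : Heisenberg n) :
    Heisenberg n →L[ℝ] Heisenberg n :=
  LinearMap.toContinuousLinearMap
    (LinearMap.transvection (-(inner ℝ e u) • symplectic h) centralDir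
        ∘ₗ A.toLinearMap ∘ₗ ((ℝ ∙ e)ᗮ.starProjection : Heisenberg n →ₗ[ℝ] Heisenberg n)
      + (innerₛₗ ℝ e).smulRight (leftField h q))

lemma hasFDerivAt_flowOut {ψ : Heisenberg n → Heisenberg n} {A : Heisenberg n →L[ℝ] Heisenberg n}
    {e u : Heisenberg n} (h : Heisenberg n)
    (hψ : HasFDerivAt ψ A ((ℝ ∙ e)ᗮ.orthogonalProjectionOnto u : Heisenberg n)) :
    HasFDerivAt (flowOut ψ e h)
      (flowOutDeriv A e h (ψ ((ℝ ∙ e)ᗮ.orthogonalProjectionOnto u)) u) u := by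
  have h1 : HasFDerivAt (fun u => ψ ((ℝ ∙ e)ᗮ.starProjection u))
      (A ∘L (ℝ ∙ e)ᗮ.starProjection) u :=
    HasFDerivAt.comp u hψ (ContinuousLinearMap.hasFDerivAt _)
  have h2 : HasFDerivAt (fun u : Heisenberg n => inner ℝ e u) (innerSL ℝ e) u :=
    (innerSL ℝ e).hasFDerivAt
  have h3 := ((LinearMap.toContinuousLinearMap (symplectic h)).hasFDerivAt (x := ψ
    ((ℝ ∙ e)ᗮ.starProjection u))).comp u h1
  -- By antisymmetry of `symplectic` the direction of motion is affine in the starting point, so the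
  -- product rule applies.
  have h4 := h1.add (h2.smul (((h3.neg).smul_const (centralDir : Heisenberg n)).const_add h))
  have h5 : flowOut ψ e h = (fun u => ψ ((ℝ ∙ e)ᗮ.starProjection u)) + fun u => inner ℝ e u •
      (h + (-(⇑(LinearMap.toContinuousLinearMap (symplectic h)) ∘
        fun u => ψ ((ℝ ∙ e)ᗮ.starProjection u))) u • (centralDir : Heisenberg n)) := by
    funext u
    simp [flowOut, mul_smul_eq_add_leftField, leftField, symplectic_comm _ h]
  rw [h5]
  refine h4.congr_fderiv ?_
  ext1 v
  simp [flowOutDeriv, LinearMap.transvection.apply, leftField, symplectic_comm _ h, smul_smul]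
  module

/-- The derivative factors as a central transvection of determinant one, then `L.symm`, then a
transvection replacing `e` by `L (leftField h q)`. The central one fixes `leftField h q`, so the
time `⟪e, u⟫` drops out of the determinant. -/
lemma det_flowOutDeriv {L : Heisenberg n ≃L[ℝ] Heisenberg n} {e : Heisenberg n} (he : ‖e‖ = 1)
    {l : Heisenberg n →ₗ[ℝ] ℝ} (hL : ∀ v, L v = LinearMap.transvection l e v)
    (h q u : Heisenberg n) :
    (flowOutDeriv (L.symm : Heisenberg n →L[ℝ] Heisenberg n) e h q u).det
      = (1 + l e)⁻¹ * (inner ℝ e (leftField h q) + l (leftField h q)) := by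
  have hdetL : LinearMap.det (L.symm : Heisenberg n →L[ℝ] Heisenberg n).toLinearMap
      = (1 + l e)⁻¹ := by
    have h1 : LinearMap.det (L : Heisenberg n →L[ℝ] Heisenberg n).toLinearMap = 1 + l e := by
      rw [← LinearMap.transvection.det]
      congr 1
      ext1 v
      exact hL v
    apply eq_inv_of_mul_eq_one_left
    rw [← h1, ← LinearMap.det_comp]
    convert! LinearMap.det_id
    ext1 v
    simp
  have hfac : (flowOutDeriv (L.symm : Heisenberg n →L[ℝ] Heisenberg n) e h q u).toLinearMap
      = LinearMap.transvection (-(inner ℝ e u) • symplectic h) centralDir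
        ∘ₗ (L.symm : Heisenberg n →L[ℝ] Heisenberg n).toLinearMap
        ∘ₗ LinearMap.transvection (innerₛₗ ℝ e) (L (leftField h q) - e) := by
    ext1 v
    have hZ : symplectic h (leftField h q) = 0 := by
      simp [leftField, symplectic_self, symplectic_centralDir]
    have hP : (ℝ ∙ e)ᗮ.starProjection v = v - inner ℝ e v • e := by
      rw [← coe_orthogonalProjectionOnto_orthogonal_unit_singleton he,
        Submodule.coe_orthogonalProjectionOnto_apply]
    simp [flowOutDeriv, LinearMap.transvection.apply, hP, hZ, smul_sub]
    module
  rw [ContinuousLinearMap.det, hfac, LinearMap.det_comp, LinearMap.det_comp, hdetL,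
    LinearMap.transvection.det, LinearMap.transvection.det, LinearMap.smul_apply,
    symplectic_centralDir, hL, LinearMap.transvection.apply]
  simp only [smul_zero, add_zero, one_mul, innerₛₗ_apply_apply, inner_add_right, inner_sub_right,
    inner_smul_right, real_inner_self_eq_norm_sq, he]
  ring

/-- The union of the horizontal segments `{e · (τ h) | 0 ≤ τ ≤ 1}` issuing from `E`. -/
def sweep (h : Heisenberg n) (E : Set (Heisenberg n)) : Set (Heisenberg n) :=
  {q | ∃ τ ∈ Icc (0 : ℝ) 1, ∃ e ∈ E, q = e * (τ • h)}

lemma outerNormal_eq {Ω U : Set (Heisenberg n)} {f : Heisenberg n → ℝ} {q : Heisenberg n}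
    (hf : IsDefiningFunctionOn Ω U f) (hU : q ∈ U) (hq : q ∈ frontier Ω) :
    outerNormal Ω q = ‖∇ f q‖⁻¹ • ∇ f q := by
  have h : ∃ ν, IsOuterUnitNormal Ω q ν := ⟨_, U, f, hU, hf, rfl⟩
  rw [outerNormal, dif_pos h]
  exact h.choose_spec.unique hq ⟨U, f, hU, hf, rfl⟩

lemma IsDefiningFunctionOn.continuousOn_gradient {Ω U : Set (Heisenberg n)}
    {f : Heisenberg n → ℝ} (hf : IsDefiningFunctionOn Ω U f) : ContinuousOn (∇ f) U :=
  (InnerProductSpace.toDual ℝ (Heisenberg n)).symm.continuous.comp_continuousOn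
    (hf.smooth.continuousOn_fderiv_of_isOpen hf.isOpen (by simp))

lemma continuous_leftField (h : Heisenberg n) : Continuous (leftField h) := by
  have : leftField h = fun q => h + (-symplectic h q) • centralDir :=
    funext fun q => by rw [leftField, symplectic_comm]
  rw [this]
  have := (symplectic h).continuous_of_finiteDimensional
  fun_prop

/-- The density of the measure swept out by the boundary along the field of `h`, in terms of a
defining function `f` and a direction `e` transversal to the boundary. -/
def sweepDensity (f : Heisenberg n → ℝ) (e h q : Heisenberg n) : ℝ :=
  |(inner ℝ (∇ f q) e)⁻¹ * inner ℝ (∇ f q) (leftField h q)|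

/-- The angle condition `he` allows `⟪∇ f q, e⟫` to be replaced by `‖∇ f q‖` at the cost of a factor
`2`, after which only the unit normal is left. -/
lemma sweepDensity_le {Ω U : Set (Heisenberg n)} {f : Heisenberg n → ℝ} {e h q : Heisenberg n}
    (hf : IsDefiningFunctionOn Ω U f) (hU : q ∈ U) (hq : q ∈ frontier Ω) (ht : t h = 0)
    (he : ‖∇ f q‖ < 2 * inner ℝ (∇ f q) e) :
    sweepDensity f e h q ≤ 2 * √(sqLen h) * horizontalNormalLength Ω q := by
  have hpos : 0 < ‖∇ f q‖ := norm_pos_iff.2 (hf.gradient_ne_zero q hU)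
  have h1 := abs_inner_leftField_le ht q (outerNormal Ω q)
  rw [outerNormal_eq hf hU hq, real_inner_smul_left, ← outerNormal_eq hf hU hq, abs_mul,
    abs_of_pos (inv_pos.2 hpos)] at h1
  have h2 : (inner ℝ (∇ f q) e)⁻¹ ≤ 2 * ‖∇ f q‖⁻¹ := by
    rw [inv_le_comm₀ (by linarith) (by positivity), mul_inv, inv_inv]
    linarith
  rw [sweepDensity, abs_mul, abs_of_pos (inv_pos.2 (by linarith))]
  calc _ ≤ 2 * ‖∇ f q‖⁻¹ * |inner ℝ (∇ f q) (leftField h q)| := by gcongr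
    _ = 2 * (‖∇ f q‖⁻¹ * |inner ℝ (∇ f q) (leftField h q)|) := by ring
    _ ≤ 2 * (√(sqLen h) * horizontalNormalLength Ω q) := mul_le_mul_of_nonneg_left h1 two_pos.le
    _ = _ := by ring

/-- The map straightening the zero set of `f` near a point with gradient `G`. -/
def straighten (f : Heisenberg n → ℝ) (G e q : Heisenberg n) : Heisenberg n :=
  q + (‖G‖⁻¹ * f q - inner ℝ e q) • e

/-- The linear form whose transvection along `e` is the derivative of `straighten` at `q`. -/
def straightenForm (f : Heisenberg n → ℝ) (G e q : Heisenberg n) : Heisenberg n →ₗ[ℝ] ℝ :=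
  ‖G‖⁻¹ • innerₛₗ ℝ (∇ f q) - innerₛₗ ℝ e

lemma straightenForm_apply (f : Heisenberg n → ℝ) (G e q v : Heisenberg n) :
    straightenForm f G e q v = ‖G‖⁻¹ * inner ℝ (∇ f q) v - inner ℝ e v := by
  simp [straightenForm]

/-- Only the coordinate along `e` changes, so the derivative is a rank-one perturbation of the
identity and its determinant is explicit. -/
lemma hasFDerivAt_straighten {f : Heisenberg n → ℝ} {q : Heisenberg n}
    (hf : DifferentiableAt ℝ f q) (G e : Heisenberg n) :
    HasFDerivAt (straighten f G e)
      (LinearMap.toContinuousLinearMap (LinearMap.transvection (straightenForm f G e q) e)) q := by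
  have h1 : HasFDerivAt f (InnerProductSpace.toDual ℝ _ (∇ f q)) q :=
    hf.hasGradientAt.hasFDerivAt
  have h2 : HasFDerivAt (fun u : Heisenberg n => inner ℝ e u) (innerSL ℝ e) q :=
    (innerSL ℝ e).hasFDerivAt
  refine ((hasFDerivAt_id q).add (((h1.const_mul ‖G‖⁻¹).sub h2).smul_const e)).congr_fderiv ?_
  ext1 v
  simp [LinearMap.transvection.apply, straightenForm_apply]

lemma measurableSet_inter_preimage_of_continuousOn {X Y : Type*} [TopologicalSpace X]
    [MeasurableSpace X] [BorelSpace X] [TopologicalSpace Y] [MeasurableSpace Y] [BorelSpace Y]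
    {g : X → Y} {s : Set X} (hs : MeasurableSet s) (hg : ContinuousOn g s) {E : Set Y}
    (hE : MeasurableSet E) : MeasurableSet (s ∩ g ⁻¹' E) := by
  rw [← Subtype.image_preimage_coe]
  exact hs.subtype_image (hg.domRestrict.measurable hE)

/-- Near a boundary point, sweeping a piece of the boundary along a horizontal segment `h`
produces volume at most `2 |h|` times its horizontal area. -/
lemma exists_isOpen_volume_sweep_le {Ω : Set (Heisenberg n)} (hΩ : HasSmoothBoundary Ω)
    {p : Heisenberg n} (hp : p ∈ frontier Ω) :
    ∃ U, IsOpen U ∧ p ∈ U ∧ ∀ h : Heisenberg n, t h = 0 → ∀ E, MeasurableSet E →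
      E ⊆ U ∩ frontier Ω →
        volume (sweep h E) ≤ ENNReal.ofReal (2 * √(sqLen h)) * boundaryArea Ω E := by
  obtain ⟨U₀, f, hpU, hf⟩ := hΩ p hp
  set G := ∇ f p with hG
  have hGpos : 0 < ‖G‖ := norm_pos_iff.2 (hf.gradient_ne_zero p hpU)
  set e := ‖G‖⁻¹ • G with he_def
  have he : ‖e‖ = 1 := by rw [he_def, norm_smul, norm_inv, norm_norm, inv_mul_cancel₀ hGpos.ne']
  have hGe : inner ℝ G e = ‖G‖ := by
    rw [he_def, inner_smul_right, real_inner_self_eq_norm_sq]; field_simp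
  -- the local diffeomorphism
  have hΦsmooth : ContDiffAt ℝ 1 (straighten f G e) p := by
    have h1 : ContDiffAt ℝ 1 f p :=
      (hf.smooth.contDiffAt (hf.isOpen.mem_nhds hpU)).of_le (by exact_mod_cast le_top)
    unfold straighten
    exact contDiffAt_id.add (((contDiffAt_const.mul h1).sub
      (contDiffAt_const.inner ℝ contDiffAt_id)).smul contDiffAt_const)
  have hΦid : HasFDerivAt (straighten f G e)
      ((ContinuousLinearEquiv.refl ℝ (Heisenberg n) : Heisenberg n ≃L[ℝ] Heisenberg n) :
        Heisenberg n →L[ℝ] Heisenberg n) p := by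
    refine (hasFDerivAt_straighten (hf.differentiableAt hpU) G e).congr_fderiv ?_
    ext1 v
    simp [LinearMap.transvection.apply, straightenForm_apply, ← hG, he_def, inner_smul_left]
  let Φ := hΦsmooth.toOpenPartialHomeomorph (straighten f G e) hΦid one_ne_zero
  have hpΦ : p ∈ Φ.source :=
    ContDiffAt.mem_toOpenPartialHomeomorph_source hΦsmooth hΦid one_ne_zero
  have hΦcoe : ∀ q, Φ q = straighten f G e q := fun q => rfl
  -- Here the gradient stays within 60° of `e`; this is the source of the factor `2`.
  let U₁ : Set (Heisenberg n) := U₀ ∩ {q | ‖∇ f q‖ < 2 * inner ℝ (∇ f q) e}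
  have hU₁open : IsOpen U₁ := by
    have hc := hf.continuousOn_gradient
    exact (hc.norm.prodMk (continuousOn_const.mul (hc.inner continuousOn_const)) :
      ContinuousOn (fun q => (‖∇ f q‖, 2 * inner ℝ (∇ f q) e)) U₀).isOpen_inter_preimage hf.isOpen
      (isOpen_lt continuous_fst continuous_snd)
  have hpU₁ : p ∈ U₁ := ⟨hpU, by change ‖G‖ < 2 * inner ℝ G e; rw [hGe]; linarith⟩
  refine ⟨U₁ ∩ Φ.source, hU₁open.inter Φ.open_source, ⟨hpU₁, hpΦ⟩, fun h ht E hE hEU => ?_⟩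
  have hEU₁ : E ⊆ U₁ := fun q hq => (hEU hq).1.1
  have hEsrc : E ⊆ Φ.source := fun q hq => (hEU hq).1.2
  have hEfr : E ⊆ frontier Ω := fun q hq => (hEU hq).2
  let K := (ℝ ∙ e)ᗮ
  let π : Heisenberg n →L[ℝ] K := K.orthogonalProjectionOnto
  have hπ : ∀ u, (π u : Heisenberg n) = u - inner ℝ e u • e :=
    coe_orthogonalProjectionOnto_orthogonal_unit_singleton he
  -- Since `f` vanishes on the boundary, straightening there is just orthogonal projection, so
  -- `Φ.symm` is a section of `π` over the image of `E`.
  have hΦE : ∀ q ∈ E, Φ q = π q := by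
    intro q hq
    rw [hΦcoe, hπ, straighten, hf.eq_zero (hEU₁ hq).1 (hEfr hq)]
    module
  have heK : ∀ w : K, inner ℝ e (w : Heisenberg n) = 0 := fun w =>
    Submodule.mem_orthogonal_singleton_iff_inner_right.1 w.2
  -- the parametrised piece of the hyperplane
  have hψc : ContinuousOn (fun w : K => Φ.symm w) (Subtype.val ⁻¹' Φ.target) :=
    Φ.continuousOn_symm.comp continuous_subtype_val.continuousOn fun w hw => hw
  let W : Set K := (Subtype.val ⁻¹' Φ.target) ∩ (fun w : K => Φ.symm w) ⁻¹' E
  have hW : MeasurableSet W := measurableSet_inter_preimage_of_continuousOn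
    (Φ.open_target.preimage continuous_subtype_val).measurableSet hψc hE
  let J : Heisenberg n → ℝ≥0∞ := fun q => ENNReal.ofReal (sweepDensity f e h q)
  have hJc : ContinuousOn J U₁ := by
    have hc := hf.continuousOn_gradient.mono (inter_subset_left : U₁ ⊆ U₀)
    refine ENNReal.continuous_ofReal.comp_continuousOn ((ContinuousOn.mul
      ((hc.inner continuousOn_const).inv₀ fun q hq => ?_)
      (hc.inner (continuous_leftField h).continuousOn)).abs)
    have := hq.2
    rw [mem_ofPred_eq] at this
    have := norm_nonneg (∇ f q)
    intro h0
    linarith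
  let F : K → ℝ≥0∞ := W.indicator fun w => J (Φ.symm w)
  have hF : Measurable F := by
    classical
    rw [show F = W.piecewise (fun w : K => J (Φ.symm w)) 0 from (piecewise_eq_indicator ..).symm]
    exact ContinuousOn.measurable_piecewise
      (hJc.comp (hψc.mono inter_subset_left) fun w hw => hEU₁ hw.2)
      continuous_zero.continuousOn hW
  -- the swept set is an image
  let S : Set (Heisenberg n) := {u | inner ℝ e u ∈ Icc (0 : ℝ) 1} ∩ π ⁻¹' W
  have hSm : MeasurableSet S :=
    (measurableSet_Icc.preimage (continuous_const.inner continuous_id).measurable).inter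
      (π.continuous.measurable hW)
  -- The point `a * (τ • h)` comes from `π a + τ • e`.
  have himage : sweep h E ⊆ flowOut Φ.symm e h '' S := by
    rintro q ⟨τ, hτ, a, ha, rfl⟩
    have h1 : π ((π a : Heisenberg n) + τ • e) = π a := by
      apply Subtype.ext
      rw [hπ, inner_add_right, heK, inner_smul_right, real_inner_self_eq_norm_sq, he]
      simp
    have h2 : inner ℝ e ((π a : Heisenberg n) + τ • e) = τ := by
      rw [inner_add_right, heK, inner_smul_right, real_inner_self_eq_norm_sq, he]
      simp
    have h3 : Φ.symm (π a) = a := by rw [← hΦE a ha, Φ.left_inv (hEsrc ha)]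
    refine ⟨(π a : Heisenberg n) + τ • e, ⟨by rwa [mem_ofPred_eq, h2], ?_⟩, ?_⟩
    · rw [mem_preimage, h1]
      refine ⟨?_, ?_⟩
      · rw [mem_preimage, ← hΦE a ha]
        exact Φ.map_source (hEsrc ha)
      · rw [mem_preimage, h3]
        exact ha
    · change Φ.symm (π ((π a : Heisenberg n) + τ • e)) * (inner ℝ e _ • h) = _
      rw [h1, h2, h3]
  have hderiv : ∀ u ∈ S, ∃ D : Heisenberg n →L[ℝ] Heisenberg n,
      HasFDerivAt (flowOut Φ.symm e h) D u ∧ ENNReal.ofReal |D.det| = F (π u) := by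
    intro u hu
    set q := Φ.symm (π u) with hq
    have hqE : q ∈ E := hu.2.2
    have hutgt : (π u : Heisenberg n) ∈ Φ.target := hu.2.1
    have hne : inner ℝ (∇ f q) e ≠ 0 := by
      have := (hEU₁ hqE).2
      rw [mem_ofPred_eq] at this
      have := norm_nonneg (∇ f q)
      intro h0
      linarith
    have hle : 1 + straightenForm f G e q e = ‖G‖⁻¹ * inner ℝ (∇ f q) e := by
      rw [straightenForm_apply, real_inner_self_eq_norm_sq, he]; ring
    let M := LinearMap.toContinuousLinearMap
      (LinearMap.transvection (straightenForm f G e q) e)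
    have hMdet : M.det ≠ 0 := by
      change LinearMap.det (LinearMap.transvection (straightenForm f G e q) e) ≠ 0
      rw [LinearMap.transvection.det, hle]
      positivity
    let L := M.toContinuousLinearEquivOfDetNeZero hMdet
    have hΦ' : HasFDerivAt Φ (L : Heisenberg n →L[ℝ] Heisenberg n) q := by
      rw [ContinuousLinearMap.coe_toContinuousLinearEquivOfDetNeZero]
      exact hasFDerivAt_straighten (hf.differentiableAt (hEU₁ hqE).1) G e
    have hψ' := Φ.hasFDerivAt_symm hutgt hΦ'
    refine ⟨_, hasFDerivAt_flowOut h hψ', ?_⟩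
    -- The terms `⟪e, leftField h q⟫` and the factors `‖G‖` cancel, leaving `sweepDensity f e h q`,
    -- which depends on `u` only through `π u`.
    rw [det_flowOutDeriv he (l := straightenForm f G e q) (fun v => rfl), hle,
      straightenForm_apply]
    have hFq : F (π u) = J q := indicator_of_mem (s := W) hu.2 _
    rw [hFq]
    change _ = ENNReal.ofReal |_|
    change ENNReal.ofReal |_ * (inner ℝ e (leftField h q) + (‖G‖⁻¹ *
      inner ℝ (∇ f q) (leftField h q) - inner ℝ e (leftField h q)))| = _
    congr 2
    field_simp
    ring
  choose! D hD hDdet using hderiv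
  calc volume (sweep h E) ≤ volume (flowOut Φ.symm e h '' S) := measure_mono himage
    _ ≤ ∫⁻ u in S, ENNReal.ofReal |(D u).det| :=
        addHaar_image_le_lintegral_abs_det_fderiv _ hSm fun u hu => (hD u hu).hasFDerivWithinAt
    _ = ∫⁻ u in S, F (π u) := setLIntegral_congr_fun hSm fun u hu => hDdet u hu
    _ ≤ ∫⁻ u in {u : Heisenberg n | inner ℝ e u ∈ Icc (0 : ℝ) 1}, F (π u) :=
        lintegral_mono_set inter_subset_left
    _ = ∫⁻ w, F w := lintegral_slab_comp_orthogonalProjection he hF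
    _ = ∫⁻ w in W, J (Φ.symm w) := lintegral_indicator hW _
    _ ≤ ∫⁻ q in E, J q ∂μHE[2 * n] := by
        refine lintegral_comp_section_le ?_ hW (hψc.mono inter_subset_left) (fun w hw => hw.2)
          (fun w hw => ?_) ((hJc.mono hEU₁).aemeasurable hE)
        · have : Fact (Module.finrank ℝ (Heisenberg n) = 2 * n + 1) := ⟨by simp; ring⟩
          exact Submodule.finrank_orthogonal_span_singleton (norm_pos_iff.1 (by rw [he]; simp))
        · apply Subtype.ext
          rw [← hΦE _ hw.2, Φ.right_inv hw.1]
    _ ≤ ∫⁻ q in E, ENNReal.ofReal (2 * √(sqLen h)) *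
          ENNReal.ofReal (horizontalNormalLength Ω q) ∂μHE[2 * n] := by
        refine setLIntegral_mono' hE fun q hq => ?_
        rw [← ENNReal.ofReal_mul (by positivity)]
        exact ENNReal.ofReal_le_ofReal
          (sweepDensity_le hf (hEU₁ hq).1 (hEfr hq) ht (hEU₁ hq).2)
    _ = ENNReal.ofReal (2 * √(sqLen h)) * boundaryArea Ω E := by
        rw [lintegral_const_mul' _ _ ENNReal.ofReal_ne_top, boundaryArea, withDensity_apply _ hE,
          Measure.restrict_restrict hE, inter_eq_left.2 hEfr]

lemma sweep_iUnion {ι : Type*} (h : Heisenberg n) (E : ι → Set (Heisenberg n)) :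
    sweep h (⋃ i, E i) ⊆ ⋃ i, sweep h (E i) := by
  rintro q ⟨τ, hτ, a, ha, rfl⟩
  obtain ⟨i, hi⟩ := mem_iUnion.1 ha
  exact mem_iUnion.2 ⟨i, τ, hτ, a, hi, rfl⟩

/-- Sweeping a part `E` of the boundary along a horizontal segment `h` produces volume at most
`2 |h|` times the horizontal area of `E`. -/
lemma volume_sweep_le {Ω : Set (Heisenberg n)} (hΩ : HasSmoothBoundary Ω) {h : Heisenberg n}
    (ht : t h = 0) {E : Set (Heisenberg n)} (hE : MeasurableSet E) (hEΩ : E ⊆ frontier Ω) :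
    volume (sweep h E) ≤ ENNReal.ofReal (2 * √(sqLen h)) * boundaryArea Ω E := by
  choose! U hUo hUm hU using fun p (hp : p ∈ frontier Ω) => exists_isOpen_volume_sweep_le hΩ hp
  obtain ⟨s, hs, hsc, hcover⟩ := TopologicalSpace.countable_cover_nhdsWithin (f := U)
    (s := frontier Ω) fun p hp => mem_nhdsWithin_of_mem_nhds ((hUo p hp).mem_nhds (hUm p hp))
  rcases s.eq_empty_or_nonempty with rfl | hne
  · have : E = ∅ := by
      rw [← subset_empty_iff]
      simpa using hEΩ.trans hcover
    simp [this, sweep]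
  obtain ⟨g, rfl⟩ := hsc.exists_eq_range hne
  have hg : ∀ i, g i ∈ frontier Ω := fun i => hs (mem_range_self i)
  -- Disjointing the countable cover lets the boundary areas add up exactly.
  let D : ℕ → Set (Heisenberg n) := disjointed fun i => U (g i)
  have hDm : ∀ i, MeasurableSet (D i) :=
    MeasurableSet.disjointed fun i => (hUo _ (hg i)).measurableSet
  have hEeq : E = ⋃ i, E ∩ D i := by
    rw [← inter_iUnion, iUnion_disjointed, eq_comm, inter_eq_left]
    simpa using hEΩ.trans hcover
  have hdisj : Pairwise (Function.onFun Disjoint fun i => E ∩ D i) := fun i j hij =>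
    (disjoint_disjointed _ hij).mono inter_subset_right inter_subset_right
  calc volume (sweep h E) ≤ volume (⋃ i, sweep h (E ∩ D i)) := by
        conv_lhs => rw [hEeq]
        exact measure_mono (sweep_iUnion _ _)
    _ ≤ ∑' i, volume (sweep h (E ∩ D i)) := measure_iUnion_le _
    _ ≤ ∑' i, ENNReal.ofReal (2 * √(sqLen h)) * boundaryArea Ω (E ∩ D i) := by
        refine ENNReal.tsum_le_tsum fun i => hU _ (hg i) h ht _ (hE.inter (hDm i)) ?_
        exact fun q hq => ⟨disjointed_subset _ i hq.2, hEΩ hq.1⟩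
    _ = ENNReal.ofReal (2 * √(sqLen h)) * boundaryArea Ω E := by
        rw [ENNReal.tsum_mul_left, ← measure_iUnion hdisj fun i => hE.inter (hDm i), ← hEeq]

/-! ### Chains of horizontal steps and the relative isoperimetric inequality. -/

lemma inv_eq_neg (p : Heisenberg n) : p⁻¹ = -p := ext_coord (fun _ => rfl) (fun _ => rfl) rfl

lemma sqLen_neg (p : Heisenberg n) : sqLen (-p) = sqLen p := by
  rw [← inv_eq_neg]
  simp only [sqLen, x_inv, y_inv, neg_sq]

lemma t_neg (p : Heisenberg n) : t (-p) = -t p := rfl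

lemma sqLen_smul (r : ℝ) (p : Heisenberg n) : sqLen (r • p) = r ^ 2 * sqLen p := by
  simp only [sqLen, x_smul, y_smul, Finset.mul_sum]
  exact Finset.sum_congr rfl fun j _ => by ring

/-- A point whose segment along `h` meets `E` is recovered by moving back from the meeting point. -/
lemma setOf_exists_mul_mem_subset_sweep (h : Heisenberg n) (E : Set (Heisenberg n)) :
    {p | ∃ τ ∈ Icc (0 : ℝ) 1, p * (τ • h) ∈ E} ⊆ sweep (-h) E := by
  rintro p ⟨τ, hτ, hp⟩
  refine ⟨τ, hτ, _, hp, ?_⟩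
  rw [smul_neg, ← inv_eq_neg, mul_inv_cancel_right]

/-- A horizontal segment from a point of `Ω` to a point outside `Ω` crosses the boundary. -/
lemma exists_mem_frontier_of_mul_notMem {Ω : Set (Heisenberg n)} {p h : Heisenberg n}
    (hp : p ∈ Ω) (hph : p * h ∉ Ω) : ∃ τ ∈ Icc (0 : ℝ) 1, p * (τ • h) ∈ frontier Ω := by
  have hc : Continuous fun τ : unitInterval => p * ((τ : ℝ) • h) :=
    continuous_const.mul (continuous_subtype_val.smul continuous_const)
  obtain ⟨τ, hτ⟩ := (nonempty_frontier_iff (s := (fun τ : unitInterval => p * ((τ : ℝ) • h)) ⁻¹' Ω)).2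
    ⟨⟨0, by simpa [mul_smul_eq_add_leftField] using hp⟩,
      (ne_univ_iff_exists_notMem _).2 ⟨1, by simpa using hph⟩⟩
  exact ⟨τ, τ.2, hc.frontier_preimage_subset _ hτ⟩

lemma rho_smul_le {h : Heisenberg n} (ht : t h = 0) {s : ℝ} (hs : 0 ≤ s) (hh : sqLen h ≤ s ^ 2)
    {τ : ℝ} (hτ : τ ∈ Icc (0 : ℝ) 1) : rho (τ • h) ≤ 2 * s := by
  refine rho_le_of_le hs ?_ ?_
  · rw [sqLen_smul]
    have : τ ^ 2 ≤ 1 := pow_le_one₀ hτ.1 hτ.2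
    nlinarith [sqLen_nonneg h]
  · rw [t_smul, ht, mul_zero, abs_zero]
    positivity

lemma mul_mem_ball {c p q : Heisenberg n} {r s : ℝ} (hp : p ∈ ball c r) (hq : rho q ≤ s) :
    p * q ∈ ball c (2 * (r + s)) := by
  have hp' : rho (c⁻¹ * p) < r := hp
  have := rho_mul_le (c⁻¹ * p) q
  rw [mul_assoc] at this
  exact lt_of_le_of_lt this (by linarith)

/-- The volume of the points of `Ω ∩ B(c, r)` which a chain of horizontal steps moves out of `Ω`
is controlled by the horizontal boundary area in an enlarged ball. -/
lemma volume_mul_prod_notMem_le {Ω : Set (Heisenberg n)} (hΩ : HasSmoothBoundary Ω)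
    (c : Heisenberg n) {s : ℝ} (hs : 0 ≤ s) (l : List (Heisenberg n)) :
    (∀ h ∈ l, t h = 0 ∧ sqLen h ≤ s ^ 2) → ∀ r, s ≤ r →
    volume {p | p ∈ ball c r ∩ Ω ∧ p * l.prod ∉ Ω} ≤
      l.length * (ENNReal.ofReal (2 * s) * boundaryArea Ω (ball c (6 ^ l.length * r))) := by
  induction l with
  | nil =>
    intro _ r _
    have : {p | p ∈ ball c r ∩ Ω ∧ p * ([] : List (Heisenberg n)).prod ∉ Ω} = ∅ := by
      ext p
      simp
    rw [this]
    simp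
  | cons h l ih =>
    intro hl r hr
    obtain ⟨ht, hh⟩ := hl h (by simp)
    have hr0 : 0 ≤ r := hs.trans hr
    -- The factor is `2 * (r + 2 * s) ≤ 6 * r`, using `s ≤ r`.
    have hstep : ∀ τ ∈ Icc (0 : ℝ) 1, ∀ p ∈ ball c r, p * (τ • h) ∈ ball c (6 * r) :=
      fun τ hτ p hp => ball_subset_ball _ (by linarith) (mul_mem_ball hp (rho_smul_le ht hs hh hτ))
    let E := ball c (6 * r) ∩ frontier Ω
    let A := {p | p ∈ ball c (6 * r) ∩ Ω ∧ p * l.prod ∉ Ω}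
    have hsub : {p | p ∈ ball c r ∩ Ω ∧ p * (h :: l).prod ∉ Ω} ⊆
        sweep (-h) E ∪ (fun p => p * h) ⁻¹' A := by
      rintro p ⟨⟨hpB, hpΩ⟩, hp⟩
      by_cases hph : p * h ∈ Ω
      · refine Or.inr ⟨⟨?_, hph⟩, ?_⟩
        · simpa using hstep 1 (by simp) p hpB
        · rwa [mul_assoc, ← List.prod_cons]
      · obtain ⟨τ, hτ, hpτ⟩ := exists_mem_frontier_of_mul_notMem hpΩ hph
        exact Or.inl (setOf_exists_mul_mem_subset_sweep h E ⟨τ, hτ, hstep τ hτ p hpB, hpτ⟩)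
    have hpow : (6 : ℝ) ^ l.length * (6 * r) = 6 ^ (h :: l).length * r := by
      rw [List.length_cons, pow_succ]; ring
    have hE : volume (sweep (-h) E) ≤
        ENNReal.ofReal (2 * s) * boundaryArea Ω (ball c (6 ^ (h :: l).length * r)) := by
      refine (volume_sweep_le hΩ (by rw [t_neg, ht, neg_zero])
        ((isOpen_ball _ _).measurableSet.inter isClosed_frontier.measurableSet)
        inter_subset_right).trans ?_
      gcongr
      · rw [sqLen_neg]
        exact Real.sqrt_le_left hs |>.2 hh
      · refine inter_subset_left.trans (ball_subset_ball _ ?_)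
        rw [← hpow]
        exact le_mul_of_one_le_left (by positivity) (one_le_pow₀ (by norm_num))
    calc _ ≤ volume (sweep (-h) E) + volume ((fun p => p * h) ⁻¹' A) :=
          (measure_mono hsub).trans (measure_union_le _ _)
      _ ≤ ENNReal.ofReal (2 * s) * boundaryArea Ω (ball c (6 ^ (h :: l).length * r)) +
          l.length * (ENNReal.ofReal (2 * s) *
            boundaryArea Ω (ball c (6 ^ (h :: l).length * r))) := by
          -- The rest of the chain starts at `p * h`; right invariance of the volume allows the
          -- induction hypothesis to be used there.
          rw [measure_preimage_mul_right, ← hpow]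
          rw [← hpow] at hE
          exact add_le_add hE (ih (fun k hk => hl k (by simp [hk])) _ (by linarith))
      _ = _ := by rw [List.length_cons]; push_cast; ring

/-- Every element of the group is a product of five horizontal elements of controlled length. -/
lemma exists_horizontal_factorization (hn : 1 ≤ n) (g : Heisenberg n) :
    ∃ l : List (Heisenberg n), l.length = 5 ∧ l.prod = g ∧
      ∀ h ∈ l, t h = 0 ∧ sqLen h ≤ rho g ^ 2 := by
  let i : Fin n := ⟨0, hn⟩
  -- The commutator of the horizontal elements `X` and `Y` below is central with `t`-coordinate `-4
  -- * a * b`. These choices make it `t g`, the part missing from the horizontal factor `mk (x g) (y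
  -- g) 0`.
  let a : ℝ := √|t g| / 2
  let b : ℝ := -(SignType.sign (t g) * a)
  have ha2 : a ^ 2 ≤ rho g ^ 2 := by
    have h1 := abs_t_le_rho_sq g
    have h2 := abs_nonneg (t g)
    rw [div_pow, Real.sq_sqrt h2]
    linarith
  have hab : 4 * (a * b) = -t g := by
    have h1 : a ^ 2 = |t g| / 4 := by
      rw [div_pow, Real.sq_sqrt (abs_nonneg _)]; norm_num
    have h2 := sign_mul_abs (t g)
    linear_combination (-4 * (SignType.sign (t g) : ℝ)) * h1 - h2
  have hb2 : b ^ 2 ≤ rho g ^ 2 := by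
    refine le_trans ?_ ha2
    have : (SignType.sign (t g) : ℝ) ^ 2 ≤ 1 := by
      rcases lt_trichotomy (t g) 0 with h | h | h <;> simp [h]
    rw [neg_sq, mul_pow]
    nlinarith [sq_nonneg a]
  let X : Heisenberg n := mk (Pi.single i a) 0 0
  let Y : Heisenberg n := mk 0 (Pi.single i b) 0
  have hX : sqLen X = a ^ 2 := by
    simp only [sqLen, X, x_mk, y_mk]
    rw [Finset.sum_eq_single i] <;> simp +contextual
  have hY : sqLen Y = b ^ 2 := by
    simp only [sqLen, Y, x_mk, y_mk]
    rw [Finset.sum_eq_single i] <;> simp +contextual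
  refine ⟨[mk (x g) (y g) 0, X, Y, X⁻¹, Y⁻¹], rfl, ?_, ?_⟩
  · simp only [List.prod_cons, List.prod_nil, mul_one]
    refine ext_coord (fun j => ?_) (fun j => ?_) ?_
    · simp [x_mul, x_inv, X, Y]
    · simp [y_mul, y_inv, X, Y]
    · simp only [t_mul, x_mul, y_mul, x_inv, y_inv, t_inv, x_mk, y_mk, t_mk, X, Y]
      simp [Pi.single_apply]
      linarith
  · intro h hh
    simp only [List.mem_cons, List.not_mem_nil, or_false] at hh
    rcases hh with rfl | rfl | rfl | rfl | rfl
    · exact ⟨rfl, sqLen_le_rho_sq g⟩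
    · exact ⟨rfl, hX.trans_le ha2⟩
    · exact ⟨rfl, hY.trans_le hb2⟩
    · exact ⟨by simp [X, t_inv], by rw [inv_eq_neg, sqLen_neg, hX]; exact ha2⟩
    · exact ⟨by simp [Y, t_inv], by rw [inv_eq_neg, sqLen_neg, hY]; exact hb2⟩

/-- The relative isoperimetric inequality in balls. -/
lemma volume_inter_mul_volume_diff_le (hn : 1 ≤ n) {Ω : Set (Heisenberg n)} (hΩo : IsOpen Ω)
    (hΩ : HasSmoothBoundary Ω) (c : Heisenberg n) {r : ℝ} (hr : 0 < r) :
    volume (ball c r ∩ Ω) * volume (ball c r \ Ω) ≤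
      5 * (ENNReal.ofReal (8 * r) * boundaryArea Ω (ball c (6 ^ 6 * r))) *
        volume (ball (1 : Heisenberg n) (4 * r)) := by
  set A := ball c r ∩ Ω
  set B := ball c r \ Ω
  set κ := 5 * (ENNReal.ofReal (8 * r) * boundaryArea Ω (ball c (6 ^ 6 * r))) with hκ
  have hA : MeasurableSet A := (isOpen_ball _ _).measurableSet.inter hΩo.measurableSet
  have hB : MeasurableSet B := (isOpen_ball _ _).measurableSet.diff hΩo.measurableSet
  have hmeas : Measurable (Function.uncurry fun p g : Heisenberg n =>
      A.indicator (fun _ => (1 : ℝ≥0∞)) p * B.indicator (fun _ => (1 : ℝ≥0∞)) (p * g)) :=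
    ((measurable_const.indicator hA).comp measurable_fst).mul
      ((measurable_const.indicator hB).comp measurable_mul)
  have hbound : ∀ g : Heisenberg n, ∫⁻ p, A.indicator (fun _ => (1 : ℝ≥0∞)) p *
      B.indicator (fun _ => (1 : ℝ≥0∞)) (p * g) ≤
        (ball (1 : Heisenberg n) (4 * r)).indicator (fun _ => κ) g := by
    intro g
    have hint : ∀ p, A.indicator (fun _ => (1 : ℝ≥0∞)) p * B.indicator (fun _ => (1 : ℝ≥0∞)) (p * g)
        = {p | p ∈ A ∧ p * g ∈ B}.indicator (fun _ => (1 : ℝ≥0∞)) p := by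
      intro p
      by_cases h1 : p ∈ A <;> by_cases h2 : p * g ∈ B <;> simp [h1, h2]
    simp_rw [hint]
    have hC : MeasurableSet {p | p ∈ A ∧ p * g ∈ B} :=
      hA.inter (hB.preimage (measurable_mul_const g))
    rw [lintegral_indicator_const hC, one_mul]
    by_cases hg : g ∈ ball (1 : Heisenberg n) (4 * r)
    · rw [indicator_of_mem hg]
      obtain ⟨l, hl5, hlg, hl⟩ := exists_horizontal_factorization hn g
      have hg' : rho g < 4 * r := by simpa [ball] using hg
      -- The chain lemma needs a starting radius at least the step bound, hence `4 * r` for both;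
      -- five steps then reach radius `6 ^ 5 * (4 * r) ≤ 6 ^ 6 * r`.
      have h1 := volume_mul_prod_notMem_le hΩ c (s := 4 * r) (by positivity) l
        (fun h hh => ⟨(hl h hh).1, (hl h hh).2.trans
          (pow_le_pow_left₀ (rho_nonneg g) hg'.le 2)⟩) (4 * r) le_rfl
      rw [hl5, hlg] at h1
      calc _ ≤ volume {p | p ∈ ball c (4 * r) ∩ Ω ∧ p * g ∉ Ω} := by
            refine measure_mono fun p hp => ⟨⟨?_, hp.1.2⟩, hp.2.2⟩
            exact ball_subset_ball c (by linarith) hp.1.1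
        _ ≤ _ := h1
        _ ≤ κ := by
          rw [hκ]
          push_cast
          refine mul_le_mul_right (mul_le_mul' (ENNReal.ofReal_le_ofReal (by linarith))
            (measure_mono (ball_subset_ball c (by linarith)))) _
    -- Two points of `ball c r` differ by an element of gauge less than `2 * (r + r)`, so no other
    -- `g` contributes.
    · rw [indicator_of_notMem hg, nonpos_iff_eq_zero]
      convert! measure_empty (μ := (volume : Measure (Heisenberg n)))
      ext p
      simp only [mem_ofPred_eq, mem_empty_iff_false, iff_false, not_and]
      intro hp hpg
      apply hg
      have h1 : rho (c⁻¹ * p) < r := hp.1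
      have h2 : rho (c⁻¹ * (p * g)) < r := hpg.1
      have h3 := rho_mul_le (p⁻¹ * c) (c⁻¹ * (p * g))
      rw [show p⁻¹ * c * (c⁻¹ * (p * g)) = g by group, rho_inv_mul_comm p c] at h3
      change rho (1⁻¹ * g) < 4 * r
      rw [inv_one, one_mul]
      linarith
  -- By left invariance `volume B` is the integral over `g` of the indicator of `p * g ∈ B`, for
  -- every `p`; Tonelli then allows `g` to be fixed first.
  calc volume A * volume B
      = ∫⁻ p, A.indicator (fun _ => (1 : ℝ≥0∞)) p * volume B := by
        rw [lintegral_mul_const _ (measurable_const.indicator hA),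
          lintegral_indicator_const hA, one_mul]
    _ = ∫⁻ p, ∫⁻ g, A.indicator (fun _ => (1 : ℝ≥0∞)) p *
          B.indicator (fun _ => (1 : ℝ≥0∞)) (p * g) := by
        refine lintegral_congr fun p => ?_
        rw [lintegral_const_mul (f := fun g => B.indicator (fun _ => (1 : ℝ≥0∞)) (p * g)) _
            ((measurable_const.indicator hB).comp (measurable_const_mul p)),
          lintegral_mul_left_eq_self (fun q => B.indicator (fun _ => (1 : ℝ≥0∞)) q) p,
          lintegral_indicator_const hB, one_mul]
    _ = ∫⁻ g, ∫⁻ p, A.indicator (fun _ => (1 : ℝ≥0∞)) p *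
          B.indicator (fun _ => (1 : ℝ≥0∞)) (p * g) := lintegral_lintegral_swap hmeas.aemeasurable
    _ ≤ ∫⁻ g, (ball (1 : Heisenberg n) (4 * r)).indicator (fun _ => κ) g := lintegral_mono hbound
    _ = κ * volume (ball (1 : Heisenberg n) (4 * r)) :=
        lintegral_indicator_const (isOpen_ball _ _).measurableSet _

end Heisenberg

/-- Write `a i ^ q = a i * a i ^ (q - 1)` and bound the second factor by the power of the whole sum.
-/
lemma ENNReal.tsum_rpow_le_rpow_tsum {ι : Type*} (a : ι → ℝ≥0∞) {q : ℝ} (hq : 1 ≤ q) :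
    ∑' i, a i ^ q ≤ (∑' i, a i) ^ q := by
  have hsplit : ∀ b : ℝ≥0∞, b ^ q = b * b ^ (q - 1) := fun b => by
    conv_lhs => rw [← add_sub_cancel 1 q,
      ENNReal.rpow_add_of_nonneg _ _ zero_le_one (sub_nonneg.2 hq), ENNReal.rpow_one]
  calc ∑' i, a i ^ q ≤ ∑' i, a i * (∑' j, a j) ^ (q - 1) := by
        refine ENNReal.tsum_le_tsum fun i => ?_
        rw [hsplit]
        gcongr
        exact ENNReal.le_tsum i
    _ = _ := by rw [ENNReal.tsum_mul_right, ← hsplit]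

/-! ### Choice of radii and the local isoperimetric inequality. -/

namespace Heisenberg

variable {n : ℕ}

/-- After translation to the identity: where `rho ≤ 1`, the squared Euclidean norm is at most `2 *
rho ^ 2`. -/
lemma exists_ball_subset {Ω : Set (Heisenberg n)} (hΩ : IsOpen Ω) {p : Heisenberg n}
    (hp : p ∈ Ω) : ∃ ε > 0, ball p ε ⊆ Ω := by
  have hnhds : (fun q => p * q) ⁻¹' Ω ∈ nhds (1 : Heisenberg n) :=
    (hΩ.preimage (continuous_const_mul p)).mem_nhds (by simpa using hp)
  obtain ⟨δ, hδ, hball⟩ := Metric.mem_nhds_iff.1 hnhds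
  refine ⟨min 1 (δ / 2), by positivity, fun q hq => ?_⟩
  have hρ : rho (p⁻¹ * q) < min 1 (δ / 2) := hq
  obtain ⟨h1, h2⟩ := lt_min_iff.1 hρ
  have h0 := rho_nonneg (p⁻¹ * q)
  have hone : (1 : Heisenberg n) = 0 := ext_coord (fun _ => rfl) (fun _ => rfl) rfl
  have hnorm : ‖p⁻¹ * q‖ < δ := by
    apply lt_of_pow_lt_pow_left₀ 2 hδ.le
    rw [norm_sq_eq]
    have h3 := sqLen_le_rho_sq (p⁻¹ * q)
    have h4 : t (p⁻¹ * q) ^ 2 ≤ rho (p⁻¹ * q) ^ 2 := by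
      rw [← sq_abs]
      refine pow_le_pow_left₀ (abs_nonneg _) ((abs_t_le_rho_sq _).trans ?_) 2
      exact pow_le_of_le_one h0 h1.le two_ne_zero
    nlinarith
  have := hball (a := p⁻¹ * q) (by rwa [hone, mem_ball_zero_iff])
  simpa using this

/-- Around each point of a bounded open set there is a ball of which the set fills a definite
proportion, but at most one half. -/
lemma exists_ball_half_filled {Ω : Set (Heisenberg n)} (hΩ : IsOpen Ω) (hfin : volume Ω ≠ ∞)
    {p : Heisenberg n} (hp : p ∈ Ω) :
    ∃ r > 0, 2 * volume (ball p r ∩ Ω) ≤ volume (ball p r) ∧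
      volume (ball p r) ≤ 2 ^ (homDim n + 1) * volume (ball p r ∩ Ω) := by
  classical
  obtain ⟨ε, hε, hball⟩ := exists_ball_subset hΩ hp
  have hvol : ∀ r > 0, volume (ball p (2 * r)) = 2 ^ homDim n * volume (ball p r) := by
    intro r hr
    rw [volume_ball_mul p p two_pos hr, ENNReal.ofReal_pow two_pos.le]
    simp
  have hex : ∃ k : ℕ, 2 * volume (ball p (2 ^ k * ε) ∩ Ω) ≤ volume (ball p (2 ^ k * ε)) := by
    have hpos := volume_ball_pos p hε
    obtain ⟨k, hk⟩ := ENNReal.exists_nat_gt (r := 2 * volume Ω / volume (ball p ε))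
      (ENNReal.div_ne_top (ENNReal.mul_ne_top (by simp) hfin) hpos.ne')
    refine ⟨k, ?_⟩
    have h1 : (k : ℝ≥0∞) ≤ ENNReal.ofReal ((2 ^ k) ^ homDim n) := by
      rw [← ENNReal.ofReal_natCast]
      refine ENNReal.ofReal_le_ofReal ?_
      calc (k : ℝ) ≤ 2 ^ k := by exact_mod_cast Nat.lt_two_pow_self.le
        _ ≤ (2 ^ k) ^ homDim n :=
          le_self_pow₀ (one_le_pow₀ (by norm_num)) (by simp [homDim])
    calc 2 * volume (ball p (2 ^ k * ε) ∩ Ω) ≤ 2 * volume Ω := by gcongr; exact inter_subset_right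
      _ ≤ k * volume (ball p ε) := ENNReal.div_le_iff_le_mul (Or.inl hpos.ne')
          (Or.inl (volume_ball_lt_top p hε).ne) |>.1 hk.le
      _ ≤ _ := by rw [volume_ball_mul p p (by positivity) hε]; gcongr
  have hspec := Nat.find_spec hex
  obtain ⟨m, hm⟩ : ∃ m, Nat.find hex = m + 1 := by
    -- At scale `0` the ball lies inside `Ω`, so it is more than half filled.
    refine Nat.exists_eq_succ_of_ne_zero fun h0 => ?_
    rw [h0, pow_zero, one_mul, inter_eq_left.2 hball, two_mul] at hspec
    exact (ENNReal.lt_add_right (volume_ball_lt_top p hε).ne (volume_ball_pos p hε).ne').not_ge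
      hspec
  -- One dyadic scale earlier the ball was more than half filled; doubling the radius costs `2 ^
  -- homDim n`.
  have hmin := Nat.find_min hex (m := m) (by omega)
  rw [hm] at hspec
  refine ⟨2 ^ (m + 1) * ε, by positivity, hspec, ?_⟩
  have hr : (2 : ℝ) ^ (m + 1) * ε = 2 * (2 ^ m * ε) := by ring
  rw [hr, hvol _ (by positivity), pow_succ, mul_assoc]
  gcongr
  refine (not_le.1 hmin).le.trans ?_
  gcongr
  exact ball_subset_ball p (by linarith [show 0 < (2 : ℝ) ^ m * ε by positivity])

/-- The constant in the local isoperimetric inequality below. -/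
def isoConst (n : ℕ) : ℝ≥0 :=
  ((2 ^ (homDim n + 2) * (4 ^ homDim n * 40)) * (volume (ball (1 : Heisenberg n) 1))⁻¹).toNNReal

/-- Both `Ω` and its complement occupy a definite part of the ball, so the relative inequality
becomes `v * v ≤ C * r * σ * v`. Cancelling `v` and then one `r` from `v = r ^ N * β` leaves `r ^ (N
- 1)`. -/
lemma rpow_le_boundaryArea (hn : 1 ≤ n) {Ω : Set (Heisenberg n)} (hΩo : IsOpen Ω)
    (hΩ : HasSmoothBoundary Ω) {p : Heisenberg n} {r : ℝ} (hr : 0 < r)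
    (h1 : 2 * volume (ball p r ∩ Ω) ≤ volume (ball p r))
    (h2 : volume (ball p r) ≤ 2 ^ (homDim n + 1) * volume (ball p r ∩ Ω)) :
    ENNReal.ofReal r ^ (homDim n - 1) ≤ isoConst n * boundaryArea Ω (ball p (6 ^ 6 * r)) := by
  set v := volume (ball p r) with hv
  set σ := boundaryArea Ω (ball p (6 ^ 6 * r)) with hσ
  set β := volume (ball (1 : Heisenberg n) 1) with hβ
  have hv0 : v ≠ 0 := (volume_ball_pos p hr).ne'
  have hvt : v ≠ ∞ := (volume_ball_lt_top p hr).ne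
  have hβ0 : β ≠ 0 := volume_unitBall_pos.ne'
  have hβt : β ≠ ∞ := volume_unitBall_lt_top.ne
  have hdiff : v ≤ 2 * volume (ball p r \ Ω) := by
    have hsplit := measure_inter_add_sdiff (μ := volume) (ball p r) hΩo.measurableSet
    have hAt : volume (ball p r ∩ Ω) ≠ ∞ := measure_ne_top_of_subset inter_subset_left hvt
    have : volume (ball p r ∩ Ω) ≤ volume (ball p r \ Ω) := by
      rw [hv, two_mul, ← hsplit] at h1
      exact (ENNReal.add_le_add_iff_left hAt).1 h1
    rw [hv, ← hsplit, two_mul]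
    gcongr
  have h4 : volume (ball (1 : Heisenberg n) (4 * r)) = 4 ^ homDim n * v := by
    rw [volume_ball_mul 1 p (by norm_num) hr, ENNReal.ofReal_pow (by norm_num)]
    simp [v]
  have h8 : ENNReal.ofReal (8 * r) = 8 * ENNReal.ofReal r := by
    rw [ENNReal.ofReal_mul (by norm_num)]; simp
  have key : v * v ≤ (2 ^ (homDim n + 2) * (4 ^ homDim n * 40)) * (ENNReal.ofReal r * σ) * v :=
    calc v * v ≤ (2 ^ (homDim n + 1) * volume (ball p r ∩ Ω)) *
            (2 * volume (ball p r \ Ω)) := mul_le_mul' h2 hdiff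
      _ = 2 ^ (homDim n + 2) * (volume (ball p r ∩ Ω) * volume (ball p r \ Ω)) := by ring
      _ ≤ 2 ^ (homDim n + 2) * (5 * (ENNReal.ofReal (8 * r) * σ) *
            volume (ball (1 : Heisenberg n) (4 * r))) := by
          exact mul_le_mul_right (volume_inter_mul_volume_diff_le hn hΩo hΩ p hr) _
      _ = _ := by rw [h4, h8]; ring
  have key2 : v ≤ (2 ^ (homDim n + 2) * (4 ^ homDim n * 40)) * (ENNReal.ofReal r * σ) :=
    (ENNReal.mul_le_mul_iff_left hv0 hvt).1 key
  have hr0 : ENNReal.ofReal r ≠ 0 := by simpa using hr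
  have hN : homDim n = (homDim n - 1) + 1 := by simp [homDim]
  have hveq : v = ENNReal.ofReal r * (ENNReal.ofReal r ^ (homDim n - 1) * β) := by
    rw [hv, volume_ball_eq p hr, ENNReal.ofReal_pow hr.le, hN, pow_succ]
    simp only [add_tsub_cancel_right]
    ring
  have key3 : ENNReal.ofReal r ^ (homDim n - 1) * β ≤
      (2 ^ (homDim n + 2) * (4 ^ homDim n * 40)) * σ := by
    refine (ENNReal.mul_le_mul_iff_right hr0 ENNReal.ofReal_ne_top).1 ?_
    rw [← hveq]
    exact key2.trans_eq (by ring)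
  have hcoe : (isoConst n : ℝ≥0∞) = (2 ^ (homDim n + 2) * (4 ^ homDim n * 40)) * β⁻¹ := by
    refine ENNReal.coe_toNNReal (ENNReal.mul_ne_top ?_ (ENNReal.inv_ne_top.2 hβ0))
    exact ENNReal.mul_ne_top (by simp) (ENNReal.mul_ne_top (by simp) (by simp))
  calc ENNReal.ofReal r ^ (homDim n - 1) = ENNReal.ofReal r ^ (homDim n - 1) * β * β⁻¹ := by
        rw [mul_assoc, ENNReal.mul_inv_cancel hβ0 hβt, mul_one]
    _ ≤ (2 ^ (homDim n + 2) * (4 ^ homDim n * 40)) * σ * β⁻¹ := by gcongr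
    _ = _ := by rw [hcoe]; ring

/-- The exponent `N / (N - 1)`. -/
def isoExp (n : ℕ) : ℝ := (homDim n : ℝ) / ((homDim n : ℝ) - 1)

lemma homDim_sub_one_pos (n : ℕ) : 0 < (homDim n : ℝ) - 1 := by
  have : (0 : ℝ) ≤ n := n.cast_nonneg
  simp only [homDim]
  push_cast
  linarith

lemma one_le_isoExp (n : ℕ) : 1 ≤ isoExp n :=
  (one_le_div (homDim_sub_one_pos n)).2 (by linarith)

lemma isoExp_pos (n : ℕ) : 0 < isoExp n := one_pos.trans_le (one_le_isoExp n)

/-! ### The weight on a single ball, Vitali covering and summation. -/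

/-- The bound for the weight of an enlarged ball by the weighted area inside the ball. -/
lemma setLIntegral_ball_le {C₀ : ℝ≥0} {ω : Heisenberg n → ℝ≥0∞} (hω : IsA1Weight C₀ ω)
    {μ : Measure (Heisenberg n)} {p : Heisenberg n} {r : ℝ} (hr : 0 < r) {K : ℝ≥0∞}
    (hμ : ENNReal.ofReal r ^ (homDim n - 1) ≤ K * μ (ball p (6 ^ 6 * r))) :
    ∫⁻ q in ball p (6 ^ 7 * r), ω q ≤
      C₀ * (6 ^ 7) ^ homDim n * volume (ball (1 : Heisenberg n) 1) * K ^ isoExp n *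
        (∫⁻ q in ball p (6 ^ 6 * r), ω q ^ (isoExp n)⁻¹ ∂μ) ^ isoExp n := by
  set R : ℝ := 6 ^ 7 * r
  have hR : 0 < R := by positivity
  set m := ⨅ z ∈ ball p R, ω z
  have hq := isoExp_pos n
  have hv0 := (volume_ball_pos p hR).ne'
  have hvt := (volume_ball_lt_top p hR).ne
  have h1 : ∫⁻ q in ball p R, ω q ≤ volume (ball p R) * (C₀ * m) := by
    rw [← ENNReal.inv_mul_le_iff hv0 hvt]
    exact hω p R hR
  have hvol : volume (ball p R) =
      (6 ^ 7) ^ homDim n * ENNReal.ofReal r ^ homDim n * volume (ball (1 : Heisenberg n) 1) := by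
    rw [volume_ball_eq p hR, mul_pow, ENNReal.ofReal_mul (by positivity),
      ENNReal.ofReal_pow (by positivity), ENNReal.ofReal_pow hr.le, ENNReal.ofReal_pow (by norm_num)]
    simp
  have h2 : ENNReal.ofReal r ^ homDim n = (ENNReal.ofReal r ^ (homDim n - 1)) ^ isoExp n := by
    rw [← ENNReal.rpow_natCast, ← ENNReal.rpow_natCast, ← ENNReal.rpow_mul, isoExp,
      Nat.cast_sub (by simp [homDim]), Nat.cast_one, mul_div_cancel₀ _ (homDim_sub_one_pos n).ne']
  -- The infimum is over the larger ball, so it bounds `ω` below on the smaller one, including on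
  -- the boundary of `Ω`, which may have volume zero; this needs the pointwise infimum.
  have h3 : μ (ball p (6 ^ 6 * r)) * m ^ (isoExp n)⁻¹ ≤
      ∫⁻ q in ball p (6 ^ 6 * r), ω q ^ (isoExp n)⁻¹ ∂μ := by
    rw [mul_comm, ← setLIntegral_const]
    refine setLIntegral_mono' (isOpen_ball _ _).measurableSet fun q hqB => ?_
    refine ENNReal.rpow_le_rpow (iInf₂_le q ?_) (inv_pos.2 hq).le
    exact ball_subset_ball p (by simp only [R]; linarith) hqB
  have h4 : ENNReal.ofReal r ^ homDim n * m ≤ K ^ isoExp n *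
      (∫⁻ q in ball p (6 ^ 6 * r), ω q ^ (isoExp n)⁻¹ ∂μ) ^ isoExp n := by
    calc ENNReal.ofReal r ^ homDim n * m
        = (ENNReal.ofReal r ^ (homDim n - 1)) ^ isoExp n * (m ^ (isoExp n)⁻¹) ^ isoExp n := by
          rw [h2, ← ENNReal.rpow_mul m, inv_mul_cancel₀ hq.ne', ENNReal.rpow_one]
      _ ≤ (K * μ (ball p (6 ^ 6 * r))) ^ isoExp n * (m ^ (isoExp n)⁻¹) ^ isoExp n := by gcongr
      _ = K ^ isoExp n * (μ (ball p (6 ^ 6 * r)) * m ^ (isoExp n)⁻¹) ^ isoExp n := by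
          rw [ENNReal.mul_rpow_of_nonneg _ _ hq.le, ENNReal.mul_rpow_of_nonneg _ _ hq.le, mul_assoc]
      _ ≤ _ := by gcongr
  calc ∫⁻ q in ball p R, ω q ≤ volume (ball p R) * (C₀ * m) := h1
    _ = C₀ * (6 ^ 7) ^ homDim n * volume (ball (1 : Heisenberg n) 1) *
          (ENNReal.ofReal r ^ homDim n * m) := by rw [hvol]; ring
    _ ≤ _ := by rw [mul_assoc _ (K ^ isoExp n)]; gcongr

/-- A Vitali-type covering lemma for families of balls with bounded radii. -/
lemma exists_disjoint_balls_cover {S : Set (Heisenberg n)} {r : Heisenberg n → ℝ}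
    (hr : ∀ p ∈ S, 0 < r p) {R : ℝ} (hR : ∀ p ∈ S, r p ≤ R) :
    ∃ u ⊆ S, u.Countable ∧ u.PairwiseDisjoint (fun p => ball p (r p)) ∧
      S ⊆ ⋃ p ∈ u, ball p (6 * r p) := by
  obtain ⟨u, huS, hdisj, hcov⟩ := Vitali.exists_disjoint_subfamily_covering_enlargement
    (fun p => ball p (r p)) S r 2 one_lt_two (fun p hp => (hr p hp).le) R hR
    (fun p hp => ⟨p, mem_ball_self p (hr p hp)⟩)
  refine ⟨u, huS, ?_, hdisj, fun p hp => ?_⟩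
  · exact hdisj.countable_of_isOpen (fun p _ => isOpen_ball _ _)
      fun p hp => ⟨p, mem_ball_self p (hr p (huS hp))⟩
  · obtain ⟨b, hb, ⟨z, hzp, hzb⟩, hle⟩ := hcov p hp
    refine mem_iUnion₂.2 ⟨b, hb, ?_⟩
    have h1 : rho (p⁻¹ * z) < r p := hzp
    have h2 : rho (b⁻¹ * z) < r b := hzb
    -- Here `r p ≤ 2 * r b`, so `2 * (r b + r p) ≤ 6 * r b`.
    have h3 := rho_mul_le (b⁻¹ * z) (z⁻¹ * p)
    rw [show b⁻¹ * z * (z⁻¹ * p) = b⁻¹ * p by group, rho_inv_mul_comm z p] at h3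
    change rho (b⁻¹ * p) < 6 * r b
    linarith

/-- The constant in the weighted isoperimetric inequality. -/
def weightedIsoConst (n : ℕ) (C₀ : ℝ≥0) : ℝ≥0 :=
  C₀ * (6 ^ 7) ^ homDim n * (volume (ball (1 : Heisenberg n) 1)).toNNReal * isoConst n ^ isoExp n

lemma coe_weightedIsoConst (n : ℕ) (C₀ : ℝ≥0) : (weightedIsoConst n C₀ : ℝ≥0∞) =
    C₀ * (6 ^ 7) ^ homDim n * volume (ball (1 : Heisenberg n) 1) *
      (isoConst n : ℝ≥0∞) ^ isoExp n := by
  rw [weightedIsoConst]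
  push_cast
  rw [ENNReal.coe_toNNReal volume_unitBall_lt_top.ne, ENNReal.coe_rpow_of_nonneg _ (isoExp_pos n).le]

/-- Supplies the bounded radii required by the Vitali lemma: for `r ≥ 1` the volume is at least `r`
times that of the unit ball. -/
lemma bddAbove_of_volume_ball_le {ι : Type*} {s : Set ι} {c : ι → Heisenberg n} {r : ι → ℝ}
    (hr : ∀ i ∈ s, 0 < r i) {M : ℝ≥0∞} (hM : M ≠ ∞)
    (h : ∀ i ∈ s, volume (ball (c i) (r i)) ≤ M) : ∃ R, ∀ i ∈ s, r i ≤ R := by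
  have hβ0 := (volume_unitBall_pos (n := n)).ne'
  refine ⟨max 1 (M / volume (ball (1 : Heisenberg n) 1)).toReal, fun i hi => ?_⟩
  rcases le_total (r i) 1 with h1 | h1
  · exact le_max_of_le_left h1
  · refine le_max_of_le_right ?_
    rw [← ENNReal.ofReal_le_iff_le_toReal (ENNReal.div_ne_top hM hβ0),
      ENNReal.le_div_iff_mul_le (Or.inl hβ0) (Or.inl volume_unitBall_lt_top.ne)]
    refine le_trans ?_ (h i hi)
    rw [volume_ball_eq _ (hr i hi)]
    gcongr
    exact le_self_pow₀ h1 (by simp [homDim])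

/-- The weighted isoperimetric inequality with an explicit constant. -/
lemma setLIntegral_le_weightedIsoConst_mul (hn : 1 ≤ n) {C₀ : ℝ≥0} {ω : Heisenberg n → ℝ≥0∞}
    (hω : IsA1Weight C₀ ω) {Ω : Set (Heisenberg n)} (hΩo : IsOpen Ω) (hfin : volume Ω ≠ ∞)
    (hΩ : HasSmoothBoundary Ω) :
    ∫⁻ p in Ω, ω p ≤ weightedIsoConst n C₀ *
      (∫⁻ p, ω p ^ (isoExp n)⁻¹ ∂(boundaryArea Ω)) ^ isoExp n := by
  choose! r hr hhalf hfill using fun p (hp : p ∈ Ω) => exists_ball_half_filled hΩo hfin hp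
  obtain ⟨R, hR⟩ := bddAbove_of_volume_ball_le (c := id) (s := Ω) hr
    (M := 2 ^ (homDim n + 1) * volume Ω) (ENNReal.mul_ne_top (by simp) hfin)
    fun p hp => (hfill p hp).trans (by gcongr; exact inter_subset_right)
  -- The radii `6 ^ 6 * r` are those of the balls carrying the boundary area, which must be
  -- disjoint; their sixfold enlargements are the balls in the `A₁` estimate.
  obtain ⟨u, huΩ, huc, hdisj, hcov⟩ := exists_disjoint_balls_cover (S := Ω)
    (r := fun p => 6 ^ 6 * r p) (R := 6 ^ 6 * R) (fun p hp => by have := hr p hp; positivity)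
    fun p hp => by have := hR p hp; gcongr
  have : Countable u := huc.to_subtype
  set I : u → ℝ≥0∞ := fun b =>
    ∫⁻ q in ball b.1 (6 ^ 6 * r b), ω q ^ (isoExp n)⁻¹ ∂(boundaryArea Ω)
  have hcov' : Ω ⊆ ⋃ b : u, ball b.1 (6 ^ 7 * r b) := by
    intro p hp
    obtain ⟨b, hb, hpb⟩ := mem_iUnion₂.1 (hcov hp)
    exact mem_iUnion.2 ⟨⟨b, hb⟩, ball_subset_ball b (by linarith) hpb⟩
  calc ∫⁻ p in Ω, ω p ≤ ∫⁻ p in ⋃ b : u, ball b.1 (6 ^ 7 * r b), ω p := lintegral_mono_set hcov'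
    _ ≤ ∑' b : u, ∫⁻ p in ball b.1 (6 ^ 7 * r b), ω p := lintegral_iUnion_le _ _
    _ ≤ ∑' b : u, weightedIsoConst n C₀ * I b ^ isoExp n := by
        refine ENNReal.tsum_le_tsum fun b => ?_
        rw [coe_weightedIsoConst]
        have hb := huΩ b.2
        exact setLIntegral_ball_le hω (hr _ hb)
          (rpow_le_boundaryArea hn hΩo hΩ (hr _ hb) (hhalf _ hb) (hfill _ hb))
    _ = weightedIsoConst n C₀ * ∑' b : u, I b ^ isoExp n := ENNReal.tsum_mul_left
    _ ≤ weightedIsoConst n C₀ * (∑' b : u, I b) ^ isoExp n := by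
        gcongr
        exact ENNReal.tsum_rpow_le_rpow_tsum _ (one_le_isoExp n)
    _ = weightedIsoConst n C₀ * (∫⁻ q in ⋃ b : u, ball b.1 (6 ^ 6 * r b),
          ω q ^ (isoExp n)⁻¹ ∂(boundaryArea Ω)) ^ isoExp n := by
        rw [lintegral_iUnion (fun b : u => (isOpen_ball _ _).measurableSet)
          (fun a b hab => hdisj a.2 b.2 fun h => hab (Subtype.ext h))]
    _ ≤ _ := by
        gcongr
        · exact (isoExp_pos n).le
        · exact Measure.restrict_le_self

end Heisenberg

end

theorem theorem4p4 (n : ℕ) (hn : 1 ≤ n) (C₀ : ℝ≥0) :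
    ∃ C₁ : ℝ≥0, ∀ ω : Heisenberg n → ℝ≥0∞, Measurable ω → Heisenberg.IsA1Weight C₀ ω →
      ∀ Ω : Set (Heisenberg n), IsOpen Ω → Bornology.IsBounded Ω →
        Heisenberg.HasSmoothBoundary Ω →
          ∫⁻ p in Ω, ω p ≤
            C₁ * (∫⁻ p, ω p ^ (((Heisenberg.homDim n : ℝ) - 1) / Heisenberg.homDim n)
              ∂(Heisenberg.boundaryArea Ω)) ^
                ((Heisenberg.homDim n : ℝ) / ((Heisenberg.homDim n : ℝ) - 1)) := by
  refine ⟨Heisenberg.weightedIsoConst n C₀, fun ω _ hω Ω hΩo hΩb hΩ => ?_⟩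
  have h := Heisenberg.setLIntegral_le_weightedIsoConst_mul hn hω hΩo hΩb.measure_lt_top.ne hΩ
  rwa [Heisenberg.isoExp, inv_div] at h
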